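/- Let $u(t,x)$ be a complex variable, with $x$ in $C=\mathbb{R}$ or $C=\mathbb{R}/L\mathbb{Z}$. A local function is a smooth function of $x$ and of finitely many of the jet variables $u,\bar u,u_x,\bar u_x,u_{xx},\bar u_{xx},\dots$ ($L$-periodic in $x$ if $C=\mathbb{R}/L\mathbb{Z}$). $D_x$ is the total derivative, and $D_x^{-1}f$, for $f$ a total $x$-derivative of a local function, is the local function $p$ with $D_xp=f$ that vanishes at $x=0$, $u=u_x=\dots=0$. Functionals $\mathfrak{F}=\int_C F\,dx$ are given by local densities $F$ modulo total $x$-derivatives of local functions, and $\delta\mathfrak{F}/\delta\bar u=\sum_k(-D_x)^k\,\partial F/\partial\bar u_k$, where $u_k=D_x^ku$. Let $\mathcal{C}$ denote complex conjugation and put $$\mathcal{H}=D_x-iu\,D_x^{-1}\mathrm{Im}(u\,\mathcal{C}),\qquad \mathcal{I}=-i,\qquad \mathcal{R}=\mathcal{H}\mathcal{I}^{-1},\qquad \mathcal{E}=\mathcal{R}\mathcal{H},$$ so that $\mathcal{H}$ is defined on the local functions $f$ for which $\mathrm{Im}(u\bar f)$ is a total $x$-derivative. An operator $\mathcal{D}$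 is called Hamiltonian if $\{\mathfrak{F},\mathfrak{G}\}=\int_C\mathrm{Re}\big(\mathcal{D}(\delta\mathfrak{F}/\delta\bar u)\,\delta\mathfrak{G}/\delta u\big)dx$ is a skew-symmetric operation satisfying the Jacobi identity on the real-valued functionals whose variational derivative lies in the domain of $\mathcal{D}$ (and this set of functionals is closed under it). **Theorem.** The operators $\mathcal{H}$, $\mathcal{I}$, $\mathcal{E}$ are Hamiltonian, and so are all real linear combinations of $\mathcal{H},\mathcal{I}$ and of $\mathcal{E},\mathcal{H},\mathcal{I}$ (on the intersection of the domains). For $n=0,1,2,\dots$ the densities $$H^{(n)}=\frac{2}{1+n}\,D_x^{-1}\,\mathrm{Im}\big(\bar u\,(i\mathcal{H})^{n+1}u\big)$$ are well defined (every $D_x^{-1}$ that occurs is applied to a total $x$-derivative), local and real. With $\mathfrak{H}^{(n)}=\int_C H^{(n)}dx$, the flow $$u_t=\mathcal{H}\big(\delta\mathfrak{H}^{(n)}/\delta\bar u\big)=\mathcal{I}\big(\delta\mathfrak{H}^{(n+1)}/\delta\bar u\big),\qquad n=0,1,2,\dots$$ (the $+n$ flow) is bi-Hamiltonian, and for $n\ge1$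 it is tri-Hamiltonian: it is also $u_t=\mathcal{E}\big(\delta\mathfrak{H}^{(n-1)}/\delta\bar u\big)$. The hierarchy is integrable: all its flows commute, every $\mathfrak{H}^{(m)}$ is a constant of motion of every flow, and the variational derivatives $\delta\mathfrak{H}^{(n)}/\delta\bar u$, $n\ge0$, are linearly independent over $\mathbb{R}$. The $+1$ flow is the NLS equation $-iu_t=u_{xx}+\frac12|u|^2u$, and the $+2$ flow is the complex mKdV equation $-u_t=u_{xxx}+\frac32|u|^2u_x$. -/

import Mathlib

open scoped ContDiff

noncomputable section

namespace VecHier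

/-- Functions on the `x`-jet space of a complex variable `u`: the arguments are `x` and
the jet coordinates `z = (u, u_x, u_xx, …)`.  Dependence on the conjugates `ū, ū_x, …` is allowed,
since no holomorphy is required. Algebraic operations and conjugation (`star`) are pointwise. -/
abbrev JetFun : Type := ℝ → (ℕ → ℂ) → ℂ

/-- `f` is a *local* (differential) function on the domain `C = ℝ/Lℤ` (with `L = 0` for `C = ℝ`):
a real-smooth function of `x` and of finitely many of the jet coordinates, `L`-periodic in `x`. -/
def IsLocal (L : ℝ) (f : JetFun) : Prop :=
  (∃ (N : ℕ) (g : ℝ × (Fin N → ℂ) → ℂ), ContDiff ℝ ∞ g ∧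
    ∀ x z, f x z = g (x, fun i => z i)) ∧
  ∀ x z, f (x + L) z = f x z

/-- The real part of a jet function. -/
def reP (f : JetFun) : JetFun := fun x z => ((f x z).re : ℂ)

/-- The imaginary part of a jet function. -/
def imP (f : JetFun) : JetFun := fun x z => ((f x z).im : ℂ)

/-- `f` is real-valued. -/
def IsReal (f : JetFun) : Prop := ∀ x z, (f x z).im = 0

/-- The coordinate function `u`. -/
def u : JetFun := fun _ z => z 0

/-- The total derivative `D_x`: differentiate along `x ↦ x + s`, `u_k ↦ u_k + s u_{k+1}`. -/
def D (f : JetFun) : JetFun := fun x z =>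
  deriv (fun s : ℝ => f (x + s) (fun k => z k + s * z (k + 1))) 0

/-- The derivative of `f` along the evolutionary vector field `v ∂/∂u`, prolonged to all jets:
the rate of change of `f` under `u_t = v`. -/
def evol (v f : JetFun) : JetFun := fun x z =>
  deriv (fun s : ℝ => f x (fun k => z k + s * (D^[k] v) x z)) 0

/-- `f` is a total `x`-derivative of a local function, i.e. `∫_C f dx` is the zero functional. -/
def IsTotal (L : ℝ) (f : JetFun) : Prop := ∃ p : JetFun, IsLocal L p ∧ D p = f

/-- `p = D_x⁻¹ f`: a local function with `D_x p = f`; the constant of integration is fixed by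
`p = 0` at the zero jet. -/
def IsAntideriv (L : ℝ) (f p : JetFun) : Prop := IsLocal L p ∧ D p = f ∧ p 0 0 = 0

open Classical in
/-- `D_x⁻¹ f`, for `f` a total `x`-derivative (and `0` otherwise). -/
def Dinv (L : ℝ) (f : JetFun) : JetFun :=
  if h : ∃ p, IsAntideriv L f p then h.choose else 0

/-- The Wirtinger derivative `∂f/∂ū_k = ½ (∂f/∂(Re u_k) + i ∂f/∂(Im u_k))`. -/
def dbar (k : ℕ) (f : JetFun) : JetFun := fun x z =>
  (1 / 2 : ℂ) *
    (deriv (fun s : ℝ => f x (Function.update z k (z k + s))) 0 +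
      Complex.I * deriv (fun s : ℝ => f x (Function.update z k (z k + s * Complex.I))) 0)

/-- The variational derivative `δ𝔉/δū = ∑_k (-D_x)^k ∂F/∂ū_k` of `𝔉 = ∫_C F dx`
(a finite sum when `F` is local). For real `F`, `δ𝔉/δu` is its complex conjugate. -/
def varDeriv (F : JetFun) : JetFun := ∑ᶠ k : ℕ, (-1 : ℂ) ^ k • D^[k] (dbar k F)

/-- A (possibly nonlocal) operator on jet functions, together with its domain. -/
structure JetOp where
  dom : JetFun → Prop
  op : JetFun → JetFun

namespace JetOp

/-- Composition `A B`. -/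
def comp (A B : JetOp) : JetOp where
  dom f := B.dom f ∧ A.dom (B.op f)
  op f := A.op (B.op f)

/-- Sum of operators, on the intersection of the domains. -/
def add (A B : JetOp) : JetOp where
  dom f := A.dom f ∧ B.dom f
  op f := A.op f + B.op f

/-- Multiplication of an operator by a real scalar. -/
def smul (a : ℝ) (A : JetOp) : JetOp where
  dom f := A.dom f
  op f := (a : ℂ) • A.op f

end JetOp

/-- `ℋ = D_x - i u D_x⁻¹ Im(u 𝒞)`, with `𝒞` complex conjugation; its domain consists of the local
`f` for which `Im(u f̄)` is a total `x`-derivative. -/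
def opH (L : ℝ) : JetOp where
  dom f := IsLocal L f ∧ IsTotal L (imP (u * star f))
  op f := D f - Complex.I • (u * Dinv L (imP (u * star f)))

/-- `ℐ = -i`. -/
def opI (L : ℝ) : JetOp where
  dom f := IsLocal L f
  op f := (-Complex.I) • f

/-- `ℐ⁻¹ = i`. -/
def opIinv (L : ℝ) : JetOp where
  dom f := IsLocal L f
  op f := Complex.I • f

/-- The recursion operator `ℛ = ℋ ℐ⁻¹`. -/
def opR (L : ℝ) : JetOp := (opH L).comp (opIinv L)

/-- `ℰ = ℛ ℋ`. -/
def opE (L : ℝ) : JetOp := (opR L).comp (opH L)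

/-- `F` is the density of a real functional on the jet space whose variational derivative lies in
the domain of the operator `A`. -/
def Admissible (L : ℝ) (A : JetOp) (F : JetFun) : Prop :=
  IsLocal L F ∧ IsReal F ∧ A.dom (varDeriv F)

/-- The density of the bracket `{𝔉, 𝔊} = ∫_C Re( A(δ𝔉/δū) δ𝔊/δu ) dx`. -/
def bracket (A : JetOp) (F G : JetFun) : JetFun :=
  reP (A.op (varDeriv F) * star (varDeriv G))

/-- `A` is a Hamiltonian operator: its bracket is a skew-symmetric operation on the functionals
on which it is defined, and it obeys the Jacobi identity. -/
def IsHamiltonian (L : ℝ) (A : JetOp) : Prop :=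
  (∀ F G, Admissible L A F → Admissible L A G → Admissible L A (bracket A F G)) ∧
  (∀ F G, Admissible L A F → Admissible L A G →
    IsTotal L (bracket A F G + bracket A G F)) ∧
  (∀ F G K, Admissible L A F → Admissible L A G → Admissible L A K →
    IsTotal L (bracket A F (bracket A G K) + bracket A G (bracket A K F) +
      bracket A K (bracket A F G)))

/-- The operator `i ℋ`. -/
def iH (L : ℝ) (f : JetFun) : JetFun := Complex.I • (opH L).op f

/-- The density `H^{(n)} = 2/(1+n) D_x⁻¹ Im( ū (iℋ)^{n+1} u )`. -/
def dens (L : ℝ) (n : ℕ) : JetFun :=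
  (2 / (1 + n) : ℂ) • Dinv L (imP (star u * (iH L)^[n + 1] u))

/-- The right-hand side `ℋ(δℌ^{(n)}/δū)` of the `+n` flow. -/
def flow (L : ℝ) (n : ℕ) : JetFun := (opH L).op (varDeriv (dens L n))

/-- `w(t,x)` solves the evolution equation `u_t = v`. -/
def Solves (v : JetFun) (w : ℝ → ℝ → ℂ) : Prop :=
  ∀ t x, deriv (fun s => w s x) t = v x (fun k => iteratedDeriv k (w t) x)

end VecHier

end

noncomputable section

namespace VecHier

/-! Everything takes place in the differential star algebra `Loc L` of local functions, modulo the
space `Tot L` of total derivatives, with the real pairing `ip a b = 2 Re (a b̄)`. Two facts drive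
the variational calculus: the pairing is nondegenerate modulo total derivatives
(`eq_zero_of_ip_mem_Tot`), and the linearization of a variational derivative is symmetric
(`ip_ev_vd_symm`).

Hamiltonian operators: that symmetry removes all derivatives of gradients from the Jacobi identity.
What remains is the cyclic sum of `defect`, which sees only the dependence of the operator on `u`
(`isHamiltonian_of`). For `ℋ` and `ℰ` the defects are explicit in the potentials `pot` and `potE`,
and their cyclic sums have explicit antiderivatives (`cyclic_HH`, `cyclic_EI`, `cyclic_EH`,
`cyclic_EE`); these are the coefficients of the quadratic form attached to a pencil, so all linear
combinations are covered at once. For closure under the bracket, the domain conditions are read as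
in Noether's theorem: invariance of the functional under phase rotation, and for `ℰ` also under
`x`-translation. Brackets inherit both.

Hierarchy: let `f_n = (iℋ)^n u`. Skewness of `ℋ` shifts an index from one factor to the other, so
every `Im (f_j f̄_k)` is a total derivative (`wd_fn_mem`); this makes each step well defined and
puts the Hamiltonians in involution. That `f_n` is the gradient of `H^{(n)}` (`vd_dn`) is a trace
identity. The generating functions of `D_x⁻¹ Im (u f̄_n)` and `f_n` form a vector `V = (Q, F)` which
`D_x` rotates, `V_x = A × V`, and which has length one (`genQ_sq_add`). Hence, up to orientation,
`det (V, ∂_w V, ∂_s V)` has `x`-derivative `∂_w A · ∂_s V - ∂_s A · ∂_w V` (`det_identity`), and the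
coefficients in `s` give the gradients. Involution then implies that the flows commute, again by
nondegeneracy and symmetry of the linearizations. -/

/-! ### Vector fields on the jet space -/

/-- `f` is a real-smooth function of `x` and of the first `N` jet coordinates. -/
def OrderLT (N : ℕ) (f : JetFun) : Prop :=
  ∃ g : ℝ × (Fin N → ℂ) → ℂ, ContDiff ℝ ∞ g ∧ ∀ x z, f x z = g (x, fun i => z i)

theorem OrderLT.mono {N M : ℕ} {f : JetFun} (h : OrderLT N f) (hNM : N ≤ M) : OrderLT M f := by
  obtain ⟨g, hg, hf⟩ := h
  refine ⟨fun p => g (p.1, fun i => p.2 (Fin.castLE hNM i)), ?_, fun x z => by simp [hf]⟩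
  exact hg.comp (by fun_prop)

theorem isLocal_iff {L : ℝ} {f : JetFun} :
    IsLocal L f ↔ (∃ N, OrderLT N f) ∧ ∀ x z, f (x + L) z = f x z := Iff.rfl

/-- The derivative of `f` along the vector field `a ∂_x + ∑ ζ_k ∂_{u_k}` on the jet space. -/
def vf (a : ℝ) (ζ : ℕ → JetFun) (f : JetFun) : JetFun := fun x z =>
  deriv (fun s : ℝ => f (x + s * a) (fun k => z k + s * ζ k x z)) 0

theorem hasDerivAt_line {N : ℕ} {f : JetFun} {g : ℝ × (Fin N → ℂ) → ℂ} (hg : ContDiff ℝ ∞ g)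
    (hf : ∀ x z, f x z = g (x, fun i => z i)) (a x : ℝ) (ζ z : ℕ → ℂ) :
    HasDerivAt (fun s : ℝ => f (x + s * a) (fun k => z k + s * ζ k))
      (fderiv ℝ g (x, fun i => z i) (a, fun i => ζ i)) 0 := by
  have hγ : HasDerivAt (fun s : ℝ => ((x + s * a, fun i : Fin N => z i + s * ζ i) :
      ℝ × (Fin N → ℂ))) (a, fun i => ζ i) 0 := by
    refine HasDerivAt.prodMk ?_ (hasDerivAt_pi.2 fun i => ?_)
    · simpa using ((hasDerivAt_id (0 : ℝ)).mul_const a).const_add x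
    · have := ((hasDerivAt_id (0 : ℝ)).ofReal_comp.mul_const (ζ i)).const_add (z i)
      simpa using this
  have hd : HasFDerivAt g (fderiv ℝ g (x, fun i => z i)) (x + 0 * a,
      fun i : Fin N => z i + (0 : ℝ) * ζ i) := by
    simpa using (hg.differentiable (by simp) (x, fun i => z i)).hasFDerivAt
  simp only [hf]
  exact HasFDerivAt.comp_hasDerivAt (0 : ℝ) hd hγ

theorem vf_eq_fderiv {N : ℕ} {f : JetFun} {g : ℝ × (Fin N → ℂ) → ℂ} (hg : ContDiff ℝ ∞ g)
    (hf : ∀ x z, f x z = g (x, fun i => z i)) (a : ℝ) (ζ : ℕ → JetFun) (x : ℝ) (z : ℕ → ℂ) :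
    vf a ζ f x z = fderiv ℝ g (x, fun i => z i) (a, fun i => ζ i x z) :=
  (hasDerivAt_line hg hf a x (fun k => ζ k x z) z).deriv

theorem OrderLT.hasDerivAt {N : ℕ} {f : JetFun} (h : OrderLT N f) (a : ℝ) (ζ : ℕ → JetFun)
    (x : ℝ) (z : ℕ → ℂ) :
    HasDerivAt (fun s : ℝ => f (x + s * a) (fun k => z k + s * ζ k x z)) (vf a ζ f x z) 0 := by
  obtain ⟨g, hg, hf⟩ := h
  rw [vf_eq_fderiv hg hf]
  exact hasDerivAt_line hg hf a x (fun k => ζ k x z) z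

/-- The orders of the coefficients of a prolonged field are unbounded in `k`; only the finitely many
that a given local function sees need a common bound. -/
theorem exists_common_order (N : ℕ) {ζ : ℕ → JetFun} (h : ∀ k, ∃ M, OrderLT M (ζ k)) :
    ∃ M, N ≤ M ∧ ∀ k < N, OrderLT M (ζ k) := by
  choose m hm using h
  exact ⟨N + ∑ k ∈ Finset.range N, m k, by omega, fun k hk => (hm k).mono <|
    (Finset.single_le_sum (f := m) (fun _ _ => Nat.zero_le _) (Finset.mem_range.2 hk)).trans
      (by omega)⟩

theorem OrderLT.vf {N M : ℕ} {f : JetFun} (h : OrderLT N f) (a : ℝ) {ζ : ℕ → JetFun}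
    (hNM : N ≤ M) (hζ : ∀ k < N, OrderLT M (ζ k)) : OrderLT M (vf a ζ f) := by
  obtain ⟨g, hg, hf⟩ := h
  choose e he hez using fun i : Fin N => hζ i i.2
  refine ⟨fun p => fderiv ℝ g (p.1, fun i => p.2 (Fin.castLE hNM i)) (a, fun i => e i p), ?_,
    fun x z => ?_⟩
  · have h1 : ContDiff ℝ ∞ (fderiv ℝ g) := hg.fderiv_right (by simp)
    have h2 : ContDiff ℝ ∞ (fun p : ℝ × (Fin M → ℂ) =>
      fderiv ℝ g (p.1, fun i => p.2 (Fin.castLE hNM i))) := h1.comp (by fun_prop)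
    exact h2.clm_apply (contDiff_const.prodMk (contDiff_pi.2 he))
  · rw [vf_eq_fderiv hg hf]
    simp [hez]

theorem IsLocal.vf {L : ℝ} {f : JetFun} (h : IsLocal L f) (a : ℝ) {ζ : ℕ → JetFun}
    (hζ : ∀ k, IsLocal L (ζ k)) : IsLocal L (vf a ζ f) := by
  obtain ⟨⟨N, hN⟩, hper⟩ := isLocal_iff.1 h
  obtain ⟨M, hNM, hM⟩ := exists_common_order N fun k => (hζ k).1
  refine ⟨⟨M, OrderLT.vf hN a hNM hM⟩, fun x z => ?_⟩
  simp only [VecHier.vf, (hζ _).2]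
  congr 1
  funext s
  rw [← hper (x + s * a)]
  congr 1
  ring

/-- The second-order terms cancel by symmetry of the second derivative. The `∂_x` coefficients are
constant, so the bracket has none. -/
theorem vf_comm {f : JetFun} {N : ℕ} (h : OrderLT N f) (a b : ℝ) {ζ η : ℕ → JetFun}
    (hζ : ∀ k, ∃ M, OrderLT M (ζ k)) (hη : ∀ k, ∃ M, OrderLT M (η k)) :
    vf a ζ (vf b η f) - vf b η (vf a ζ f) = vf 0 (fun k => vf a ζ (η k) - vf b η (ζ k)) f := by
  obtain ⟨g, hg, hf⟩ := h
  have h1 : ContDiff ℝ ∞ (fderiv ℝ g) := hg.fderiv_right (by simp)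
  have key : ∀ (a b : ℝ) (ζ η : ℕ → JetFun) (_ : ∀ k, ∃ M, OrderLT M (η k)) (x : ℝ) (z : ℕ → ℂ),
      vf a ζ (vf b η f) x z =
        fderiv ℝ (fderiv ℝ g) (x, fun i => z i) (a, fun i => ζ i x z) (b, fun i => η i x z) +
        fderiv ℝ g (x, fun i => z i) (0, fun i => vf a ζ (η i) x z) := by
    intro a b ζ η hη x z
    have hγ : HasDerivAt (fun s : ℝ => ((x + s * a, fun i : Fin N => z i + s * ζ i x z) :
        ℝ × (Fin N → ℂ))) (a, fun i => ζ i x z) 0 := by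
      refine HasDerivAt.prodMk ?_ (hasDerivAt_pi.2 fun i => ?_)
      · simpa using ((hasDerivAt_id (0 : ℝ)).mul_const a).const_add x
      · have := ((hasDerivAt_id (0 : ℝ)).ofReal_comp.mul_const (ζ i x z)).const_add (z i)
        simpa using this
    have hd : HasFDerivAt (fderiv ℝ g) (fderiv ℝ (fderiv ℝ g) (x, fun i => z i)) (x + 0 * a,
        fun i : Fin N => z i + (0 : ℝ) * ζ i x z) := by
      simpa using (h1.differentiable (by simp) (x, fun i => z i)).hasFDerivAt
    have hc := HasFDerivAt.comp_hasDerivAt (0 : ℝ) hd hγ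
    have hY : HasDerivAt (fun s : ℝ => ((b, fun i : Fin N => η i (x + s * a)
        (fun k => z k + s * ζ k x z)) : ℝ × (Fin N → ℂ))) (0, fun i => vf a ζ (η i) x z) 0 := by
      refine (hasDerivAt_const _ _).prodMk (hasDerivAt_pi.2 fun i => ?_)
      obtain ⟨M, hM⟩ := hη i
      exact hM.hasDerivAt a ζ x z
    have := (hc.clm_apply hY).deriv
    simp only [Function.comp_apply, zero_mul, add_zero, Complex.ofReal_zero] at this
    rw [← this, vf]
    congr 1
    funext s
    exact vf_eq_fderiv hg hf b η _ _
  funext x z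
  have hsymm : IsSymmSndFDerivAt ℝ g (x, fun i => z i) :=
    hg.contDiffAt.isSymmSndFDerivAt (by simpa using (WithTop.coe_le_coe.2 (le_top : (2 : ℕ∞) ≤ ⊤)))
  rw [Pi.sub_apply, Pi.sub_apply, key a b ζ η hη, key b a η ζ hζ, vf_eq_fderiv hg hf,
    hsymm.eq (a, fun i => ζ i x z) (b, fun i => η i x z), add_sub_add_left_eq_sub, ← map_sub]
  congr 1
  ext <;> simp

theorem D_eq_vf : D = vf 1 (fun k _ z => z (k + 1)) := by
  funext f x z; simp [D, vf]

theorem evol_eq_vf (v : JetFun) : evol v = vf 0 (fun k => D^[k] v) := by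
  funext f x z; simp [evol, vf]

theorem IsLocal.comp₂ {L : ℝ} {f g : JetFun} (hf : IsLocal L f) (hg : IsLocal L g)
    {φ : ℂ → ℂ → ℂ} (hφ : ContDiff ℝ ∞ (Function.uncurry φ)) :
    IsLocal L (fun x z => φ (f x z) (g x z)) := by
  obtain ⟨⟨N, hN⟩, hfp⟩ := isLocal_iff.1 hf
  obtain ⟨⟨M, hM⟩, hgp⟩ := isLocal_iff.1 hg
  obtain ⟨a, ha, hfa⟩ := hN.mono (le_max_left N M)
  obtain ⟨b, hb, hgb⟩ := hM.mono (le_max_right N M)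
  exact ⟨⟨_, fun p => φ (a p) (b p), hφ.comp (ha.prodMk hb), fun x z => by
    simp only [hfa, hgb]⟩, fun x z => by simp only [hfp, hgp]⟩

theorem isLocal_const (L : ℝ) (c : ℂ) : IsLocal L (fun _ _ => c) :=
  ⟨⟨0, fun _ => c, contDiff_const, fun _ _ => rfl⟩, fun _ _ => rfl⟩

theorem isLocal_coord (L : ℝ) (k : ℕ) : IsLocal L (fun _ z => z k) :=
  ⟨⟨k + 1, fun p => p.2 (Fin.last k), by fun_prop, fun _ _ => rfl⟩, fun _ _ => rfl⟩

/-! ### The algebra of local functions and its derivations -/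

/-- The star algebra of local functions. -/
def Loc (L : ℝ) : StarSubalgebra ℂ JetFun where
  carrier := {f | IsLocal L f}
  mul_mem' {f g} hf hg := hf.comp₂ hg (φ := fun a b => a * b) (by fun_prop)
  add_mem' {f g} hf hg := hf.comp₂ hg (φ := fun a b => a + b) (by fun_prop)
  algebraMap_mem' c := isLocal_const L c
  star_mem' {f} hf := hf.comp₂ hf (φ := fun a _ => star a)
    (Complex.conjCLE.contDiff.comp contDiff_fst)

variable {L : ℝ}

@[ext] theorem Loc.ext {f g : Loc L} (h : ∀ x z, (f : JetFun) x z = (g : JetFun) x z) : f = g :=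
  Subtype.ext (funext₂ h)

theorem Loc.hasDerivAt (f : Loc L) (a : ℝ) (ζ : ℕ → JetFun) (x : ℝ) (z : ℕ → ℂ) :
    HasDerivAt (fun s : ℝ => (f : JetFun) (x + s * a) (fun k => z k + s * ζ k x z))
      (vf a ζ f x z) 0 := by
  obtain ⟨⟨N, hN⟩, -⟩ := isLocal_iff.1 f.2
  exact hN.hasDerivAt a ζ x z

theorem coe_algebraMap (c : ℂ) (x : ℝ) (z : ℕ → ℂ) :
    ((algebraMap ℂ (Loc L) c : Loc L) : JetFun) x z = c := rfl

/-- The vector field `a ∂_x + ∑ ζ_k ∂_{u_k}` as a derivation of the local functions. -/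
def vfD (a : ℝ) (ζ : ℕ → Loc L) : Derivation ℂ (Loc L) (Loc L) :=
  Derivation.mk'
    { toFun := fun f => ⟨vf a (fun k => ζ k) f, f.2.vf a fun k => (ζ k).2⟩
      map_add' := fun f g => Loc.ext fun x z =>
        ((Loc.hasDerivAt f a _ x z).add (Loc.hasDerivAt g a _ x z)).deriv
      map_smul' := fun c f => Loc.ext fun x z => ((Loc.hasDerivAt f a _ x z).const_mul c).deriv }
    fun f g => Loc.ext fun x z => by
      have := ((Loc.hasDerivAt f a (fun k => ζ k) x z).mul
        (Loc.hasDerivAt g a (fun k => ζ k) x z)).deriv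
      simp only [zero_mul, add_zero, Complex.ofReal_zero] at this
      exact this.trans (by
        change _ = (f : JetFun) x z * vf a (fun k => ζ k) g x z +
          (g : JetFun) x z * vf a (fun k => ζ k) f x z
        ring)

theorem coe_vfD (a : ℝ) (ζ : ℕ → Loc L) (f : Loc L) :
    (vfD a ζ f : JetFun) = vf a (fun k => ζ k) f := rfl

theorem vfD_star (a : ℝ) (ζ : ℕ → Loc L) (f : Loc L) : vfD a ζ (star f) = star (vfD a ζ f) :=
  Loc.ext fun x z => (Loc.hasDerivAt f a (fun k => ζ k) x z).star.deriv

theorem vfD_comm (a b : ℝ) (ζ η : ℕ → Loc L) (f : Loc L) :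
    vfD a ζ (vfD b η f) - vfD b η (vfD a ζ f) =
      vfD 0 (fun k => vfD a ζ (η k) - vfD b η (ζ k)) f := by
  obtain ⟨⟨N, hN⟩, -⟩ := isLocal_iff.1 f.2
  exact Subtype.ext (vf_comm hN a b (fun k => (ζ k).2.1) fun k => (η k).2.1)

/-- The jet coordinate `u_k`. -/
def jet (k : ℕ) : Loc L := ⟨fun _ z => z k, isLocal_coord L k⟩

theorem vfD_jet (a : ℝ) (ζ : ℕ → Loc L) (k : ℕ) : vfD a ζ (jet k) = ζ k := by
  refine Loc.ext fun x z => ?_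
  have h := ((hasDerivAt_id (0 : ℝ)).ofReal_comp.mul_const ((ζ k : JetFun) x z)).const_add (z k)
  simp only [Complex.ofReal_one, one_mul] at h
  exact h.deriv

theorem vfD_eq_zero {ζ : ℕ → Loc L} (h : ∀ k, ζ k = 0) (f : Loc L) :
    vfD 0 ζ f = 0 := by
  refine Loc.ext fun x z => ?_
  simp [coe_vfD, vf, h]

theorem vfD_comm_of_eq {a b : ℝ} {ζ η : ℕ → Loc L} (h : ∀ k, vfD a ζ (η k) = vfD b η (ζ k))
    (f : Loc L) : vfD a ζ (vfD b η f) = vfD b η (vfD a ζ f) := by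
  rw [← sub_eq_zero, vfD_comm, vfD_eq_zero fun k => sub_eq_zero.2 (h k)]

/-- The total derivative. -/
def Dt : Derivation ℂ (Loc L) (Loc L) := vfD 1 fun k => jet (k + 1)

theorem coe_Dt (f : Loc L) : (Dt f : JetFun) = D f := by rw [D_eq_vf]; rfl

theorem coe_Dt_iterate (k : ℕ) (f : Loc L) : ((Dt^[k] f : Loc L) : JetFun) = D^[k] f := by
  induction k with
  | zero => rfl
  | succ k ih => rw [Function.iterate_succ_apply', Function.iterate_succ_apply', coe_Dt, ih]

/-- The derivative along an evolutionary vector field. -/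
def ev (v : Loc L) : Derivation ℂ (Loc L) (Loc L) := vfD 0 fun k => Dt^[k] v

theorem coe_ev (v f : Loc L) : (ev v f : JetFun) = evol v f := by
  rw [evol_eq_vf]
  simp only [ev, coe_vfD, coe_Dt_iterate]

/-- The partial derivative in the direction `c` of the jet coordinate `u_k`. -/
def pd (k : ℕ) (c : ℂ) : Derivation ℂ (Loc L) (Loc L) :=
  vfD 0 fun j => algebraMap ℂ (Loc L) (if j = k then c else 0)

theorem Dt_star (f : Loc L) : Dt (star f) = star (Dt f) := vfD_star _ _ f
theorem ev_star (v f : Loc L) : ev v (star f) = star (ev v f) := vfD_star _ _ f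
theorem pd_star (k : ℕ) (c : ℂ) (f : Loc L) : pd k c (star f) = star (pd k c f) := vfD_star _ _ f

theorem Dt_jet (k : ℕ) : Dt (jet k : Loc L) = jet (k + 1) := vfD_jet _ _ _
theorem ev_jet (v : Loc L) (k : ℕ) : ev v (jet k) = Dt^[k] v := vfD_jet _ _ _
theorem pd_jet (k j : ℕ) (c : ℂ) :
    pd k c (jet j : Loc L) = algebraMap ℂ (Loc L) (if j = k then c else 0) := vfD_jet _ _ _

theorem ev_Dt (v f : Loc L) : ev v (Dt f) = Dt (ev v f) :=
  vfD_comm_of_eq (fun k => by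
    rw [vfD_jet, Function.iterate_succ_apply']
    rfl) f

theorem ev_Dt_iterate (v f : Loc L) (k : ℕ) : ev v (Dt^[k] f) = Dt^[k] (ev v f) := by
  induction k with
  | zero => rfl
  | succ k ih => rw [Function.iterate_succ_apply', Function.iterate_succ_apply', ev_Dt, ih]

theorem iterate_Dt_sub (k : ℕ) (f g : Loc L) : Dt^[k] (f - g) = Dt^[k] f - Dt^[k] g := by
  induction k with
  | zero => rfl
  | succ k ih => simp only [Function.iterate_succ_apply', ih, map_sub]

theorem ev_comm (v w f : Loc L) :
    ev v (ev w f) - ev w (ev v f) = ev (ev v w - ev w v) f := by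
  have h := vfD_comm 0 0 (fun k => Dt^[k] v) (fun k => Dt^[k] w) f
  refine h.trans ?_
  simp only [ev, iterate_Dt_sub]
  congr! 3 with k
  congr 1
  · exact ev_Dt_iterate v w k
  · exact ev_Dt_iterate w v k

/-- Since `D_x u_k = u_{k+1}`, the total derivative raises the order by one, with top coefficient
the old top partial derivative. All order-counting arguments rest on this. -/
theorem pd_succ_Dt (k : ℕ) (c : ℂ) (f : Loc L) :
    pd (k + 1) c (Dt f) = Dt (pd (k + 1) c f) + pd k c f := by
  have h := vfD_comm 0 1 (fun j => algebraMap ℂ (Loc L) (if j = k + 1 then c else 0))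
    (fun j => jet (j + 1)) f
  rw [← sub_eq_iff_eq_add']
  refine h.trans ?_
  simp only [pd, vfD_jet, Derivation.map_algebraMap, sub_zero, add_left_inj]

theorem pd_zero_Dt (c : ℂ) (f : Loc L) : pd 0 c (Dt f) = Dt (pd 0 c f) :=
  vfD_comm_of_eq (fun k => by rw [vfD_jet, Derivation.map_algebraMap]; simp) f

theorem pd_comm (j k : ℕ) (c d : ℂ) (f : Loc L) : pd j c (pd k d f) = pd k d (pd j c f) :=
  vfD_comm_of_eq (fun i => by rw [Derivation.map_algebraMap, Derivation.map_algebraMap]) f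

/-! ### Order of a local function and the kernel of the total derivative -/

theorem pd_eq_fderiv {f : Loc L} {N : ℕ} {g : ℝ × (Fin N → ℂ) → ℂ} (hg : ContDiff ℝ ∞ g)
    (hf : ∀ x z, (f : JetFun) x z = g (x, fun i => z i)) (k : Fin N) (c : ℂ) (x : ℝ) (z : ℕ → ℂ) :
    (pd k c f : JetFun) x z = fderiv ℝ g (x, fun i => z i) (0, Pi.single k c) := by
  rw [pd, coe_vfD, vf_eq_fderiv hg hf]
  congr 2
  ext i
  simp only [Pi.single_apply, Fin.ext_iff]
  rfl

theorem prod_pi_eq_sum {N : ℕ} (y : Fin N → ℂ) :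
    ((0 : ℝ), y) = ∑ k, ((0 : ℝ), Pi.single k (y k)) := by
  ext i
  · simp [Prod.fst_sum]
  · simp [Prod.snd_sum, Finset.sum_apply, Pi.single_apply]

theorem exists_pd_eq_zero (f : Loc L) : ∃ N, ∀ k ≥ N, ∀ c, pd k c f = 0 := by
  obtain ⟨⟨N, g, hg, hf⟩, -⟩ := f.2
  refine ⟨N, fun k hk c => Loc.ext fun x z => ?_⟩
  have hk' (i : Fin N) : (i : ℕ) ≠ k := by omega
  simp [pd, coe_vfD, vf, hf, hk']

/-- Lowering the order of an antiderivative. -/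
theorem pd_eq_zero_of_Dt {p : Loc L} {N : ℕ} (h : ∀ k > N, ∀ c, pd k c (Dt p) = 0) :
    ∀ k ≥ N, ∀ c, pd k c p = 0 := by
  obtain ⟨M, hM⟩ := exists_pd_eq_zero p
  have key : ∀ n, ∀ k, k ≥ N → k + n ≥ M → ∀ c, pd k c p = 0 := by
    intro n
    induction n with
    | zero => exact fun k _ hk c => hM k hk c
    | succ n ih =>
      intro k hk hkn c
      have h1 := pd_succ_Dt k c p
      rw [h (k + 1) (by omega), ih (k + 1) (by omega) (by omega), map_zero, zero_add] at h1
      exact h1.symm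
  exact fun k hk c => key M k hk (by omega) c

theorem Dt_eq_zero {p : Loc L} (h : Dt p = 0) :
    ∃ c, p = algebraMap ℂ (Loc L) c := by
  have hp : ∀ k c, pd k c p = 0 := fun k c =>
    pd_eq_zero_of_Dt (N := 0) (fun k _ c => by rw [h, map_zero]) k (Nat.zero_le _) c
  obtain ⟨⟨N, g, hg, hf⟩, -⟩ := p.2
  have hgz : ∀ y, fderiv ℝ g y = 0 := by
    rintro ⟨x, y⟩
    obtain ⟨z, rfl⟩ : ∃ z : ℕ → ℂ, (fun i : Fin N => z i) = y :=
      ⟨fun k => if hk : k < N then y ⟨k, hk⟩ else 0, by ext i; simp⟩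
    have h1 (k : Fin N) (c : ℂ) : fderiv ℝ g (x, fun i => z i) (0, Pi.single k c) = 0 := by
      rw [← pd_eq_fderiv hg hf, hp]
      rfl
    have h2 (y : Fin N → ℂ) : fderiv ℝ g (x, fun i => z i) (0, y) = 0 := by
      rw [prod_pi_eq_sum, map_sum]
      exact Finset.sum_eq_zero fun k _ => h1 k (y k)
    have h3 : fderiv ℝ g (x, fun i => z i) (1, fun i => z (i + 1)) = 0 := by
      have := congrFun (congrFun (congrArg Subtype.val h) x) z
      rw [Dt, coe_vfD, vf_eq_fderiv hg hf] at this
      exact this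
    refine ContinuousLinearMap.ext fun v => ?_
    -- The direction of `D_x` and the jet directions together span, so the whole derivative
    -- vanishes.
    have : v = v.1 • ((1 : ℝ), fun i : Fin N => z (i + 1)) +
        (0, v.2 - v.1 • fun i : Fin N => z (i + 1)) := by
      ext <;> simp
    rw [this, map_add, map_smul, h2, h3]
    simp
  refine ⟨(p : JetFun) 0 0, Loc.ext fun x z => ?_⟩
  change _ = (p : JetFun) 0 0
  rw [hf, hf]
  exact is_const_of_fderiv_eq_zero (hg.differentiable (by simp)) hgz _ _

/-! ### Variational calculus modulo total derivatives -/

/-- The total `x`-derivatives of local functions. -/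
def Tot (L : ℝ) : Submodule ℂ (Loc L) :=
  LinearMap.range (Dt : Derivation ℂ (Loc L) (Loc L)).toLinearMap

theorem mem_Tot {f : Loc L} : f ∈ Tot L ↔ ∃ p, Dt p = f := Iff.rfl

theorem Dt_mem_Tot (p : Loc L) : Dt p ∈ Tot L := ⟨p, rfl⟩

theorem isTotal_coe {f : Loc L} : IsTotal L f ↔ f ∈ Tot L := by
  refine ⟨fun ⟨p, hp, h⟩ => ⟨⟨p, hp⟩, Subtype.ext ?_⟩, fun ⟨p, h⟩ => ⟨p, p.2, ?_⟩⟩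
  · exact (coe_Dt _).trans h
  · rw [← h]
    exact (coe_Dt p).symm

theorem ev_mem_Tot (v : Loc L) {f : Loc L} (h : f ∈ Tot L) : ev v f ∈ Tot L := by
  obtain ⟨p, rfl⟩ := h
  exact ⟨ev v p, (ev_Dt v p).symm⟩

/-- Twice the real part of `a b̄`. -/
def ip (a b : Loc L) : Loc L := a * star b + star a * b

theorem star_ip (a b : Loc L) : star (ip a b) = ip a b := by simp [ip]; ring

theorem ip_neg_right (a b : Loc L) : ip a (-b) = -ip a b := by simp [ip]; ring

theorem ip_sub_right (a b c : Loc L) : ip a (b - c) = ip a b - ip a c := by simp [ip]; ring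

theorem ip_sum_right {ι : Type*} (s : Finset ι) (a : Loc L) (b : ι → Loc L) :
    ip a (∑ k ∈ s, b k) = ∑ k ∈ s, ip a (b k) := by
  simp [ip, Finset.mul_sum, Finset.sum_add_distrib]

theorem Dt_ip (a b : Loc L) : Dt (ip a b) = ip (Dt a) b + ip a (Dt b) := by
  simp only [ip, map_add, Derivation.leibniz, Dt_star, smul_eq_mul]
  ring

theorem ev_ip (v a b : Loc L) : ev v (ip a b) = ip (ev v a) b + ip a (ev v b) := by
  simp only [ip, map_add, Derivation.leibniz, ev_star, smul_eq_mul]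
  ring

theorem ip_iterate_Dt (k : ℕ) (a b : Loc L) :
    ip (Dt^[k] a) b - ip a ((-1 : ℂ) ^ k • Dt^[k] b) ∈ Tot L := by
  induction k generalizing b with
  | zero => simp
  | succ k ih =>
    have h1 := Dt_mem_Tot (ip (Dt^[k] a) b)
    have h2 := (Tot L).sub_mem h1 (ih (Dt b))
    rw [Dt_ip] at h2
    convert h2 using 1
    rw [Function.iterate_succ_apply', Function.iterate_succ_apply, pow_succ, mul_neg_one, neg_smul,
      ip_neg_right]
    ring

/-- The Wirtinger derivative with respect to `ū_k`. -/
def db (k : ℕ) (F : Loc L) : Loc L := (1 / 2 : ℂ) • (pd k 1 F + Complex.I • pd k Complex.I F)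

theorem coe_pd (k : ℕ) (c : ℂ) (F : Loc L) (x : ℝ) (z : ℕ → ℂ) : (pd k c F : JetFun) x z =
    deriv (fun s : ℝ => (F : JetFun) x (Function.update z k (z k + s * c))) 0 := by
  rw [pd, coe_vfD, vf]
  congr! 3 with s
  · simp
  · ext j
    rcases eq_or_ne j k with rfl | h
    · simp [coe_algebraMap]
    · simp [h]

theorem coe_db (k : ℕ) (F : Loc L) : (db k F : JetFun) = dbar k F := by
  funext x z
  change (1 / 2 : ℂ) * ((pd k 1 F : JetFun) x z +
    Complex.I * (pd k Complex.I F : JetFun) x z) = _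
  simp only [coe_pd, mul_one, dbar]

/-- The chain rule, with each `ζ_k` split into real and imaginary parts because `F` is only
real-differentiable. One `N` serves all `ζ`. -/
theorem vfD_eq_sum (F : Loc L) : ∃ N, (∀ k ≥ N, ∀ c, pd k c F = 0) ∧ ∀ ζ : ℕ → Loc L,
    vfD 0 ζ F = ∑ k ∈ Finset.range N, (1 / 2 : ℂ) • ((ζ k + star (ζ k)) * pd k 1 F
      + Complex.I • ((star (ζ k) - ζ k) * pd k Complex.I F)) := by
  obtain ⟨⟨N, g, hg, hf⟩, -⟩ := F.2
  refine ⟨N, fun k hk c => Loc.ext fun x z => ?_, fun ζ => Loc.ext fun x z => ?_⟩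
  · have hk' (i : Fin N) : (i : ℕ) ≠ k := by omega
    simp [coe_pd, hf, hk']
  · rw [coe_vfD, vf_eq_fderiv hg hf, prod_pi_eq_sum, map_sum, Finset.sum_range]
    rw [show ((∑ k : Fin N, (1 / 2 : ℂ) • ((ζ k + star (ζ k)) * pd k 1 F
      + Complex.I • ((star (ζ k) - ζ k) * pd k Complex.I F)) : Loc L) : JetFun) x z =
      ∑ k : Fin N, (((1 / 2 : ℂ) • ((ζ k + star (ζ k)) * pd k 1 F
      + Complex.I • ((star (ζ k) - ζ k) * pd k Complex.I F)) : Loc L) : JetFun) x z by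
        rw [AddSubmonoidClass.coe_finsetSum, Finset.sum_apply, Finset.sum_apply]]
    refine Finset.sum_congr rfl fun k _ => ?_
    change _ = (1 / 2 : ℂ) * (((ζ k : JetFun) x z + star ((ζ k : JetFun) x z)) *
      (pd k 1 F : JetFun) x z + Complex.I * ((star ((ζ k : JetFun) x z) - (ζ k : JetFun) x z) *
      (pd k Complex.I F : JetFun) x z))
    rw [pd_eq_fderiv hg hf, pd_eq_fderiv hg hf]
    have h : ((0 : ℝ), (Pi.single k ((ζ k : JetFun) x z) : Fin N → ℂ)) =
        ((ζ k : JetFun) x z).re • (0, Pi.single k 1) +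
        ((ζ k : JetFun) x z).im • (0, Pi.single k Complex.I) := by
      ext i
      · simp
      · rcases eq_or_ne i k with rfl | hi
        · simpa [mul_comm] using (Complex.re_add_im _).symm
        · simp [hi]
    rw [h, map_add, map_smul, map_smul]
    apply Complex.ext <;> simp <;> ring

theorem exists_varDeriv_eq_sum (F : Loc L) : ∃ N, (∀ k ≥ N, ∀ c, pd k c F = 0) ∧
    (∀ ζ : ℕ → Loc L, vfD 0 ζ F =
      ∑ k ∈ Finset.range N, (1 / 2 : ℂ) • ((ζ k + star (ζ k)) * pd k 1 F
      + Complex.I • ((star (ζ k) - ζ k) * pd k Complex.I F))) ∧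
    varDeriv F = ((∑ k ∈ Finset.range N, (-1 : ℂ) ^ k • Dt^[k] (db k F) : Loc L) : JetFun) := by
  obtain ⟨N, hN, hs⟩ := vfD_eq_sum F
  refine ⟨N, hN, hs, ?_⟩
  have hterm (k : ℕ) : (-1 : ℂ) ^ k • D^[k] (dbar k F) =
      (((-1 : ℂ) ^ k • Dt^[k] (db k F) : Loc L) : JetFun) := by
    rw [← coe_db, ← coe_Dt_iterate]
    rfl
  simp only [varDeriv, hterm]
  rw [finsum_eq_sum_of_support_subset (s := Finset.range N),
    AddSubmonoidClass.coe_finsetSum]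
  intro k hk
  by_contra hkN
  refine hk ?_
  have hkN' : N ≤ k := by simpa using hkN
  simp [db, hN k hkN', iterate_map_zero]

/-- The variational derivative of a local function. -/
def vd (F : Loc L) : Loc L := ⟨varDeriv F, by
  obtain ⟨N, -, -, h⟩ := exists_varDeriv_eq_sum F
  rw [h]
  exact Subtype.property _⟩

theorem coe_vd (F : Loc L) : (vd F : JetFun) = varDeriv F := rfl

/-- First variation formula: integrate by parts in each term of the chain rule. Reality of `F` makes
the `u`-part conjugate to the `ū`-part. -/
theorem ev_sub_ip_vd_mem (w : Loc L) {F : Loc L} (hF : star F = F) :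
    ev w F - ip w (vd F) ∈ Tot L := by
  obtain ⟨N, -, hs, hv⟩ := exists_varDeriv_eq_sum F
  have hv' : vd F = ∑ k ∈ Finset.range N, (-1 : ℂ) ^ k • Dt^[k] (db k F) := Subtype.ext hv
  rw [hv', ip_sum_right, ev, hs, ← Finset.sum_sub_distrib]
  refine Submodule.sum_mem _ fun k _ => ?_
  convert ip_iterate_Dt k w (db k F) using 1
  congr 1
  have h1 (c : ℂ) : star (pd k c F) = pd k c F := by rw [← pd_star, hF]
  simp only [ip, db, star_smul, star_add, h1, Complex.star_def, Complex.conj_I, map_div₀, map_one,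
    map_ofNat]
  simp only [Algebra.smul_def, map_neg]
  ring

/-- A total derivative is affine in its highest jet variables. The test function is chosen so that
the density is quadratic in them with leading coefficient proportional to `|k|²`. -/
theorem eq_zero_of_ip_mem_Tot {k : Loc L} (h : ∀ w, ip w k ∈ Tot L) : k = 0 := by
  obtain ⟨N, hN⟩ := exists_pd_eq_zero k
  -- `m = 2 Re u_{N+1}` is of higher order than `k`.
  set m : Loc L := jet (N + 1) + star (jet (N + 1)) with hm
  obtain ⟨p, hp⟩ := h (m ^ 2 * k)
  change Dt p = _ at hp
  have hip : ip (m ^ 2 * k) k = m ^ 2 * (2 * (k * star k)) := by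
    simp [ip, hm]; ring
  rw [hip] at hp
  have hk (j : ℕ) (hj : j ≥ N) (c : ℂ) : pd j c (2 * (k * star k)) = 0 := by
    rw [two_mul, map_add, Derivation.leibniz, pd_star, hN j hj]
    simp
  have hmj (j : ℕ) (hj : j > N + 1) (c : ℂ) : pd j c m = 0 := by
    rw [hm, map_add, pd_star, pd_jet, if_neg (by omega)]
    simp
  have hm1 : pd (N + 1) 1 m = 2 := by
    rw [hm, map_add, pd_star, pd_jet, if_pos rfl]
    simp
    norm_num
  have hp0 := pd_eq_zero_of_Dt (p := p) (N := N + 1) fun j hj c => by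
    rw [hp, Derivation.leibniz, hk j (by omega), pow_two, Derivation.leibniz, hmj j hj]
    simp
  have h1 := pd_succ_Dt N 1 p
  rw [hp0 (N + 1) le_rfl, map_zero, zero_add] at h1
  have h2 : pd (N + 1) 1 (pd (N + 1) 1 (Dt p)) = 0 := by
    rw [h1, pd_comm, hp0 (N + 1) le_rfl, map_zero]
  -- As `m` has derivative `2`, the second derivative of `m²` is `8`, and the density is `2 m²
  -- |k|²`.
  have h3 : (16 : Loc L) * (k * star k) = 0 := by
    rw [← h2, hp]
    simp only [pow_two, Derivation.leibniz, hm1, hk (N + 1) (by omega), smul_eq_mul, mul_zero,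
      zero_add, map_add]
    have h5 : pd (N + 1) 1 (2 : Loc L) = 0 := by
      rw [show (2 : Loc L) = algebraMap ℂ (Loc L) 2 from (map_ofNat _ 2).symm,
        Derivation.map_algebraMap]
    simp only [h5]
    ring
  refine Loc.ext fun x z => ?_
  have h4 : (16 : ℂ) * ((k : JetFun) x z * star ((k : JetFun) x z)) = 0 :=
    congrFun (congrFun (congrArg Subtype.val h3) x) z
  simpa using h4

/-- Helmholtz condition: compare the two orders of the second variation, whose commutator is again a
first variation, along `ev v w - ev w v`. -/
theorem ip_ev_vd_symm (v w : Loc L) {F : Loc L} (hF : star F = F) :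
    ip w (ev v (vd F)) - ip v (ev w (vd F)) ∈ Tot L := by
  have h1 := ev_mem_Tot v (ev_sub_ip_vd_mem w hF)
  have h2 := ev_mem_Tot w (ev_sub_ip_vd_mem v hF)
  have h3 := ev_sub_ip_vd_mem (ev v w - ev w v) hF
  rw [← ev_comm] at h3
  rw [map_sub, ev_ip] at h1 h2
  convert (Tot L).sub_mem h3 ((Tot L).sub_mem h1 h2) using 1
  simp only [ip, star_sub]
  ring

theorem eq_of_ip_sub_mem_Tot {h k : Loc L} (H : ∀ w, ip w h - ip w k ∈ Tot L) : h = k := by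
  rw [← sub_eq_zero]
  exact eq_zero_of_ip_mem_Tot fun w => by rw [ip_sub_right]; exact H w

theorem vd_eq_of_ev_sub_mem_Tot {F h : Loc L} (hF : star F = F)
    (H : ∀ w, ev w F - ip w h ∈ Tot L) : vd F = h := by
  refine eq_of_ip_sub_mem_Tot fun w => ?_
  convert (Tot L).sub_mem (H w) (ev_sub_ip_vd_mem w hF) using 1
  ring

theorem mem_Tot_of_two_mul {f : Loc L} (h : 2 * f ∈ Tot L) : f ∈ Tot L := by
  have := (Tot L).smul_mem (1 / 2 : ℂ) h
  convert this using 1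
  rw [← map_ofNat (algebraMap ℂ (Loc L)) 2, ← Algebra.smul_def, smul_smul]
  norm_num

/-! ### Normalized antiderivatives and the operator `ℋ` -/

/-- The imaginary unit as a local function. -/
def J : Loc L := algebraMap ℂ (Loc L) Complex.I

theorem J_mul_J : (J * J : Loc L) = -1 := by
  rw [J, ← map_mul, Complex.I_mul_I, map_neg, map_one]

theorem star_J : star (J : Loc L) = -J := by
  rw [J, ← algebraMap_star_comm]
  simp

theorem derivation_J (d : Derivation ℂ (Loc L) (Loc L)) : d J = 0 := d.map_algebraMap _

theorem derivation_two (d : Derivation ℂ (Loc L) (Loc L)) : d 2 = 0 := by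
  rw [← map_ofNat (algebraMap ℂ (Loc L)) 2, Derivation.map_algebraMap]

theorem J_smul (f : Loc L) : Complex.I • f = J * f := Algebra.smul_def _ _

theorem J_mul_mem_Tot {f : Loc L} (h : f ∈ Tot L) : J * f ∈ Tot L := by
  rw [← J_smul]
  exact (Tot L).smul_mem _ h

/-- The local function `u`. -/
def U : Loc L := jet 0

theorem ev_U (v : Loc L) : ev v U = v := ev_jet v 0

/-- The normalized antiderivative. -/
def di (f : Loc L) : Loc L := ⟨Dinv L f, by
  unfold Dinv
  split_ifs with h
  · exact h.choose_spec.1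
  · exact (0 : Loc L).2⟩

theorem coe_di (f : Loc L) : (di f : JetFun) = Dinv L f := rfl

theorem eq_of_Dt_eq {p q : Loc L} (h : Dt p = Dt q) (h0 : (p : JetFun) 0 0 = (q : JetFun) 0 0) :
    p = q := by
  obtain ⟨c, hc⟩ := Dt_eq_zero (p := p - q) (by rw [map_sub, h, sub_self])
  have : (p : JetFun) 0 0 - (q : JetFun) 0 0 = c :=
    congrFun (congrFun (congrArg Subtype.val hc) 0) 0
  rw [h0, sub_self] at this
  rw [← sub_eq_zero, hc, ← this, map_zero]

theorem isAntideriv_di {f : Loc L} (h : f ∈ Tot L) : IsAntideriv L f (di f) := by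
  have hex : ∃ p, IsAntideriv L f p := by
    obtain ⟨p, hp⟩ := h
    refine ⟨(p - algebraMap ℂ (Loc L) ((p : JetFun) 0 0) : Loc L), Subtype.property _, ?_, ?_⟩
    · rw [← coe_Dt, map_sub, Derivation.map_algebraMap, sub_zero]
      exact congrArg Subtype.val hp
    · exact sub_self _
  rw [coe_di, Dinv, dif_pos hex]
  exact hex.choose_spec

theorem Dt_di {f : Loc L} (h : f ∈ Tot L) : Dt (di f) = f :=
  Subtype.ext ((coe_Dt _).trans (isAntideriv_di h).2.1)

theorem di_zero_jet {f : Loc L} (h : f ∈ Tot L) : (di f : JetFun) 0 0 = 0 := (isAntideriv_di h).2.2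

theorem di_eq {f p : Loc L} (h : Dt p = f) (h0 : (p : JetFun) 0 0 = 0) : di f = p := by
  have hf : f ∈ Tot L := ⟨p, h⟩
  exact eq_of_Dt_eq (by rw [Dt_di hf, h]) (by rw [di_zero_jet hf, h0])

theorem star_di {f : Loc L} (h : f ∈ Tot L) (hf : star f = f) : star (di f) = di f := by
  refine (di_eq (by rw [Dt_star, Dt_di h, hf]) ?_).symm
  change star ((di f : JetFun) 0 0) = 0
  rw [di_zero_jet h, star_zero]

/-- A local function that vanishes at the zero jet, for all `x`. -/
def VanishesAtZero (f : Loc L) : Prop := ∀ x, (f : JetFun) x 0 = 0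

theorem coe_Dt_zero_jet (f : Loc L) (x : ℝ) :
    (Dt f : JetFun) x 0 = deriv (fun y => (f : JetFun) y 0) x := by
  rw [coe_Dt, D]
  have : (fun k : ℕ => (0 : ℕ → ℂ) k) = 0 := rfl
  simp only [Pi.zero_apply, mul_zero, add_zero]
  rw [deriv_comp_const_add (fun y => (f : JetFun) y fun _ => 0) x 0, add_zero]
  rfl

theorem VanishesAtZero.Dt {f : Loc L} (h : VanishesAtZero f) : VanishesAtZero (Dt f) := by
  intro x
  rw [coe_Dt_zero_jet, funext h, deriv_const]

theorem VanishesAtZero.di {f : Loc L} (hf : f ∈ Tot L) (h : VanishesAtZero f) :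
    VanishesAtZero (di f) := by
  intro x
  have hd : Differentiable ℝ fun y => (VecHier.di f : JetFun) y 0 := by
    obtain ⟨⟨N, g, hg, hfg⟩, -⟩ := (VecHier.di f).2
    simp only [hfg]
    exact (hg.differentiable (by simp)).comp (by fun_prop)
  have := is_const_of_deriv_eq_zero hd (fun y => by rw [← coe_Dt_zero_jet, Dt_di hf, h]) x 0
  rw [this, di_zero_jet hf]

/-- The imaginary part. -/
def im (f : Loc L) : Loc L := (Complex.I / 2) • (star f - f)

theorem coe_im (f : Loc L) : (im f : JetFun) = imP f := by
  funext x z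
  change Complex.I / 2 * (star ((f : JetFun) x z) - (f : JetFun) x z) = _
  apply Complex.ext
  · simp [imP]
    ring
  · simp [imP]

theorem two_mul_im (f : Loc L) : 2 * im f = J * (star f - f) := by
  rw [im, ← map_ofNat (algebraMap ℂ (Loc L)) 2, ← Algebra.smul_def, smul_smul, J,
    ← Algebra.smul_def]
  congr 1
  ring

theorem star_im (f : Loc L) : star (im f) = im f := by
  rw [im, star_smul, star_sub, star_star, ← neg_sub, smul_neg, ← neg_smul]
  simp [neg_div]

/-- `Im (u f̄)`, whose antiderivative enters `ℋ f`. -/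
def charge (f : Loc L) : Loc L := im (U * star f)

/-- The domain of `ℋ`. -/
def HDom (f : Loc L) : Prop := charge f ∈ Tot L

/-- The nonlocal part `i D_x⁻¹ Im(u f̄)` of `ℋ f`, up to the factor `-u`. -/
def pot (f : Loc L) : Loc L := J * di (charge f)

/-- The operator `ℋ`. -/
def Hop (f : Loc L) : Loc L := Dt f - U * pot f

theorem two_Dt_pot {f : Loc L} (h : HDom f) : 2 * Dt (pot f) = U * star f - star U * f := by
  rw [pot, Derivation.leibniz, derivation_J, Dt_di h, smul_zero, add_zero, smul_eq_mul,
    mul_left_comm, charge, two_mul_im, star_mul, star_star]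
  linear_combination (star U * f - U * star f) * (J_mul_J (L := L))

theorem star_pot {f : Loc L} (h : HDom f) : star (pot f) = -pot f := by
  rw [pot, star_mul, star_J, star_di h (star_im _)]
  ring

theorem Dt_eq_Hop_add (f : Loc L) : Dt f = Hop f + U * pot f := by rw [Hop]; ring

theorem dom_opH {f : Loc L} : (opH L).dom f ↔ HDom f := by
  change IsLocal L f ∧ IsTotal L (imP (u * star (f : JetFun))) ↔ _
  rw [HDom, ← isTotal_coe, charge, coe_im]
  exact and_iff_right f.2

theorem coe_Hop (f : Loc L) : (Hop f : JetFun) = (opH L).op f := by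
  change (Dt f : JetFun) - u * (J * di (charge f) : Loc L) = D f - _
  rw [coe_Dt]
  congr 1
  rw [← J_smul]
  change u * (Complex.I • Dinv L (charge f)) = _
  rw [charge, coe_im, mul_smul_comm]
  rfl

/-- `-2i Im (a b̄)`. -/
def wd (a b : Loc L) : Loc L := star a * b - a * star b

/-- Skewness of `ℋ`: the local part integrates to `ip f g`, and the nonlocal parts combine into the
derivative of the product of the two potentials. -/
theorem ip_Hop_add (f g : Loc L) (hf : HDom f) (hg : HDom g) :
    ip (Hop f) g + ip (Hop g) f ∈ Tot L := by
  refine mem_Tot.2 ⟨ip f g - 2 * (pot f * pot g), ?_⟩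
  simp only [Hop, ip, map_sub, map_add, Derivation.leibniz, Dt_star, smul_eq_mul, star_sub,
    star_mul, star_pot hf, star_pot hg]
  rw [derivation_two]
  linear_combination (-pot f) * two_Dt_pot hg - pot g * two_Dt_pot hf

/-! ### Defects and their cyclic sums -/

/-- The failure of `A` to be a constant skew-adjoint operator along `v`. -/
def defect (A : Loc L → Loc L) (v g k : Loc L) : Loc L := ip (ev v (A g)) k + ip (A k) (ev v g)

/-- Only the two factors `u` in `-u D_x⁻¹ Im(u 𝒞)` vary. The outer one gives the term in `pot g`;
the inner one, after moving `D_x⁻¹` to the other side, gives the term in `pot k`. -/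
theorem defect_Hop (v : Loc L) {g k : Loc L} (hg : HDom g) (hk : HDom k) :
    defect Hop v g k - (pot g * wd v k - pot k * wd v g) ∈ Tot L := by
  have hg' := congrArg (ev v) (two_Dt_pot hg)
  have hs : star (ev v (pot g)) = - ev v (pot g) := by rw [← ev_star, star_pot hg, map_neg]
  simp only [map_sub, Derivation.leibniz, ev_star, smul_eq_mul, derivation_two, ev_U, ev_Dt] at hg'
  refine mem_Tot.2 ⟨ip (ev v g) k - 2 * (ev v (pot g) * pot k), ?_⟩
  simp only [defect, wd, Hop, ip, map_sub, map_add, Derivation.leibniz, Dt_star, smul_eq_mul,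
    star_sub, star_add, star_mul, star_pot hg, star_pot hk, ev_Dt, ev_U, derivation_two, hs]
  linear_combination (-pot k) * hg' - ev v (pot g) * two_Dt_pot hk

/-- The operator `ℰ`. -/
def Eop (f : Loc L) : Loc L := Hop (J * Hop f)

/-- The domain of `ℰ`. -/
def EDom (f : Loc L) : Prop := HDom f ∧ HDom (J * Hop f)

/-- The second potential that enters `ℰ f`. -/
def potE (f : Loc L) : Loc L := -J * pot (J * Hop f)

/-- `-i ℰ f`. -/
def eps (f : Loc L) : Loc L := Dt (Hop f) - U * potE f

theorem pot_J_Hop (f : Loc L) : pot (J * Hop f) = J * potE f := by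
  rw [potE]
  linear_combination (pot (J * Hop f)) * J_mul_J (L := L)

theorem Eop_eq (f : Loc L) : Eop f = J * eps f := by
  rw [Eop, Hop, pot_J_Hop, Derivation.leibniz, derivation_J, eps]
  simp only [smul_eq_mul, mul_zero, add_zero]
  ring

theorem two_Dt_potE {f : Loc L} (h : HDom (J * Hop f)) :
    2 * Dt (potE f) = -(U * star (Hop f) + star U * Hop f) := by
  rw [potE, Derivation.leibniz, map_neg, derivation_J, neg_zero, smul_zero, add_zero, smul_eq_mul,
    mul_left_comm, two_Dt_pot h, star_mul, star_J]
  linear_combination (U * star (Hop f) + star U * Hop f) * J_mul_J (L := L)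

theorem star_potE {f : Loc L} (h : HDom (J * Hop f)) : star (potE f) = potE f := by
  rw [potE, star_mul, star_pot h, star_neg, star_J]
  ring

/-- Product rule for `ℰ = ℋ J ℋ`: vary the outer `ℋ`, then the inner one, and add two instances of
`defect_Hop`. -/
theorem defect_Eop (v : Loc L) {g k : Loc L} (hg : EDom g) (hk : EDom k) :
    defect Eop v g k - J * (potE g * wd v k - potE k * wd v g + pot g * ip v (Hop k) -
      pot k * ip v (Hop g)) ∈ Tot L := by
  have h1 := defect_Hop v hg.2 hk.1
  have h2 := defect_Hop v hg.1 hk.2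
  rw [pot_J_Hop] at h1 h2
  convert (Tot L).add_mem h1 h2 using 1
  simp only [defect, Eop, ip, wd, star_mul, star_J, Derivation.leibniz, derivation_J,
    smul_eq_mul, mul_zero, add_zero]
  ring

section
variable {f g k : Loc L}

/-- The antiderivative is the cyclic sum of `pot g * wd f k`; terms with a differentiated potential
cancel in it. All relations for the potentials carry a factor `2`, hence the doubling. -/
theorem cyclic_HH (hf : HDom f) (hg : HDom g) (hk : HDom k) :
    (pot g * wd (Hop f) k - pot k * wd (Hop f) g) + (pot k * wd (Hop g) f - pot f * wd (Hop g) k) +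
      (pot f * wd (Hop k) g - pot g * wd (Hop k) f) ∈ Tot L := by
  refine mem_Tot_of_two_mul <| mem_Tot.2
    ⟨2 * (pot g * wd f k + pot k * wd g f + pot f * wd k g), ?_⟩
  simp only [wd, Derivation.leibniz, map_add, map_sub, Dt_star, smul_eq_mul, derivation_two,
    Dt_eq_Hop_add f, Dt_eq_Hop_add g, Dt_eq_Hop_add k, star_add, star_mul, star_pot hf,
    star_pot hg, star_pot hk]
  linear_combination (star f * k - f * star k) * two_Dt_pot hg +
    (star g * f - g * star f) * two_Dt_pot hk + (star k * g - k * star g) * two_Dt_pot hf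

theorem cyclic_EI (hf : EDom f) (hg : EDom g) (hk : EDom k) :
    (potE g * ip f k - potE k * ip f g + pot g * wd f (Hop k) - pot k * wd f (Hop g)) +
    (potE k * ip g f - potE f * ip g k + pot k * wd g (Hop f) - pot f * wd g (Hop k)) +
    (potE f * ip k g - potE g * ip k f + pot f * wd k (Hop g) - pot g * wd k (Hop f)) ∈ Tot L := by
  obtain ⟨hf, -⟩ := hf
  obtain ⟨hg, -⟩ := hg
  obtain ⟨hk, -⟩ := hk
  refine mem_Tot_of_two_mul <| mem_Tot.2
    ⟨2 * (pot g * wd f k + pot k * wd g f + pot f * wd k g), ?_⟩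
  simp only [wd, ip, Derivation.leibniz, map_add, map_sub, Dt_star, smul_eq_mul, derivation_two,
    Dt_eq_Hop_add f, Dt_eq_Hop_add g, Dt_eq_Hop_add k, star_add, star_mul, star_pot hf,
    star_pot hg, star_pot hk]
  linear_combination (star f * k - f * star k) * two_Dt_pot hg +
    (star g * f - g * star f) * two_Dt_pot hk + (star k * g - k * star g) * two_Dt_pot hf

theorem cyclic_EH (hf : EDom f) (hg : EDom g) (hk : EDom k) :
    (potE g * wd (Hop f) k - potE k * wd (Hop f) g + pot g * ip (Hop f) (Hop k)
      - pot k * ip (Hop f) (Hop g) - (pot g * ip (eps f) k - pot k * ip (eps f) g)) +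
    (potE k * wd (Hop g) f - potE f * wd (Hop g) k + pot k * ip (Hop g) (Hop f)
      - pot f * ip (Hop g) (Hop k) - (pot k * ip (eps g) f - pot f * ip (eps g) k)) +
    (potE f * wd (Hop k) g - potE g * wd (Hop k) f + pot f * ip (Hop k) (Hop g)
      - pot g * ip (Hop k) (Hop f) - (pot f * ip (eps k) g - pot g * ip (eps k) f)) ∈ Tot L := by
  obtain ⟨hf, hf'⟩ := hf
  obtain ⟨hg, hg'⟩ := hg
  obtain ⟨hk, hk'⟩ := hk
  refine mem_Tot_of_two_mul <| mem_Tot.2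
    ⟨2 * ((potE g * wd f k - pot g * (ip (Hop f) k - ip (Hop k) f)) +
      (potE k * wd g f - pot k * (ip (Hop g) f - ip (Hop f) g)) +
      (potE f * wd k g - pot f * (ip (Hop k) g - ip (Hop g) k))), ?_⟩
  simp only [wd, ip, eps, Derivation.leibniz, map_add, map_sub, Dt_star, smul_eq_mul,
    derivation_two, Dt_eq_Hop_add f, Dt_eq_Hop_add g, Dt_eq_Hop_add k, star_add, star_sub, star_mul,
    star_pot hf, star_pot hg, star_pot hk, star_potE hf', star_potE hg', star_potE hk']
  linear_combination (star f * k - f * star k) * two_Dt_potE hg' +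
    (star g * f - g * star f) * two_Dt_potE hk' + (star k * g - k * star g) * two_Dt_potE hf' -
    (Hop f * star k + star (Hop f) * k - (Hop k * star f + star (Hop k) * f)) * two_Dt_pot hg -
    (Hop g * star f + star (Hop g) * f - (Hop f * star g + star (Hop f) * g)) * two_Dt_pot hk -
    (Hop k * star g + star (Hop k) * g - (Hop g * star k + star (Hop g) * k)) * two_Dt_pot hf

theorem cyclic_EE (hf : EDom f) (hg : EDom g) (hk : EDom k) :
    (potE g * ip (eps f) k - potE k * ip (eps f) g + pot g * wd (eps f) (Hop k)
      - pot k * wd (eps f) (Hop g)) +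
    (potE k * ip (eps g) f - potE f * ip (eps g) k + pot k * wd (eps g) (Hop f)
      - pot f * wd (eps g) (Hop k)) +
    (potE f * ip (eps k) g - potE g * ip (eps k) f + pot f * wd (eps k) (Hop g)
      - pot g * wd (eps k) (Hop f)) ∈ Tot L := by
  obtain ⟨hf, hf'⟩ := hf
  obtain ⟨hg, hg'⟩ := hg
  obtain ⟨hk, hk'⟩ := hk
  refine mem_Tot_of_two_mul <| mem_Tot.2
    ⟨2 * ((pot g * wd (Hop f) (Hop k) + potE g * (ip (Hop f) k - ip (Hop k) f)) +
      (pot k * wd (Hop g) (Hop f) + potE k * (ip (Hop g) f - ip (Hop f) g)) +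
      (pot f * wd (Hop k) (Hop g) + potE f * (ip (Hop k) g - ip (Hop g) k))), ?_⟩
  simp only [wd, ip, eps, Derivation.leibniz, map_add, map_sub, Dt_star, smul_eq_mul,
    derivation_two, Dt_eq_Hop_add f, Dt_eq_Hop_add g, Dt_eq_Hop_add k, star_add, star_sub, star_mul,
    star_pot hf, star_pot hg, star_pot hk, star_potE hf', star_potE hg', star_potE hk']
  linear_combination (star (Hop f) * Hop k - Hop f * star (Hop k)) * two_Dt_pot hg +
    (star (Hop g) * Hop f - Hop g * star (Hop f)) * two_Dt_pot hk +
    (star (Hop k) * Hop g - Hop k * star (Hop g)) * two_Dt_pot hf +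
    (Hop f * star k + star (Hop f) * k - (Hop k * star f + star (Hop k) * f)) * two_Dt_potE hg' +
    (Hop g * star f + star (Hop g) * f - (Hop f * star g + star (Hop f) * g)) * two_Dt_potE hk' +
    (Hop k * star g + star (Hop k) * g - (Hop g * star k + star (Hop g) * k)) * two_Dt_potE hf'

end

/-! ### Reduction of the Hamiltonian property to identities of local functions -/

theorem isReal_coe {F : Loc L} : IsReal F ↔ star F = F := by
  refine ⟨fun h => Loc.ext fun x z => Complex.conj_eq_iff_im.2 (h x z), fun h x z => ?_⟩
  exact Complex.conj_eq_iff_im.1 (congrFun (congrFun (congrArg Subtype.val h) x) z)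

theorem eq_zero_of_two_mul {f : Loc L} (h : 2 * f = 0) : f = 0 := by
  have := congrArg ((1 / 2 : ℂ) • ·) h
  simp only [smul_zero] at this
  rw [← this, ← map_ofNat (algebraMap ℂ (Loc L)) 2, ← Algebra.smul_def, smul_smul]
  norm_num

theorem half_smul_mem_Tot {f : Loc L} (h : f ∈ Tot L) : (1 / 2 : ℂ) • f ∈ Tot L :=
  (Tot L).smul_mem _ h

theorem coe_half_ip (a b : Loc L) :
    (((1 / 2 : ℂ) • ip a b : Loc L) : JetFun) = reP (a * star (b : JetFun)) := by
  funext x z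
  change (1 / 2 : ℂ) * ((a : JetFun) x z * star ((b : JetFun) x z) +
    star ((a : JetFun) x z) * (b : JetFun) x z) =
    (((a : JetFun) x z * star ((b : JetFun) x z)).re : ℂ)
  apply Complex.ext
  · simp; ring
  · simp; ring

theorem star_half_ip (a b : Loc L) : star ((1 / 2 : ℂ) • ip a b) = (1 / 2 : ℂ) • ip a b := by
  rw [star_smul, star_ip]
  simp

/-- A criterion for an operator to be Hamiltonian, in terms of local functions only. -/
theorem isHamiltonian_of {A : JetOp} {dom : Loc L → Prop} {op : Loc L → Loc L}
    (hdom : ∀ f : Loc L, A.dom f ↔ dom f) (hop : ∀ f : Loc L, (op f : JetFun) = A.op f)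
    (skew : ∀ f g, dom f → dom g → ip (op f) g + ip (op g) f ∈ Tot L)
    (jacobi : ∀ f g k, dom f → dom g → dom k →
      defect op (op f) g k + defect op (op g) k f + defect op (op k) f g ∈ Tot L)
    (closed : ∀ F G : Loc L, star F = F → star G = G → dom (vd F) → dom (vd G) →
      dom (vd ((1 / 2 : ℂ) • ip (op (vd F)) (vd G)))) : IsHamiltonian L A := by
  have hbr (F G : Loc L) : bracket A F G =
      (((1 / 2 : ℂ) • ip (op (vd F)) (vd G) : Loc L) : JetFun) := by
    rw [coe_half_ip, hop]
    rfl
  have hlift {F : JetFun} (hF : Admissible L A F) :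
      ∃ F' : Loc L, star F' = F' ∧ dom (vd F') ∧ (F' : JetFun) = F :=
    ⟨⟨F, hF.1⟩, isReal_coe.1 hF.2.1, (hdom _).1 hF.2.2, rfl⟩
  refine ⟨fun F G hFa hGa => ?_, fun F G hFa hGa => ?_, fun F G K hFa hGa hKa => ?_⟩
  · obtain ⟨F, hF, hF', rfl⟩ := hlift hFa
    obtain ⟨G, hG, hG', rfl⟩ := hlift hGa
    rw [hbr]
    exact ⟨Subtype.property _, isReal_coe.2 (star_half_ip _ _),
      (hdom _).2 (closed F G hF hG hF' hG')⟩
  · obtain ⟨F, hF, hF', rfl⟩ := hlift hFa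
    obtain ⟨G, hG, hG', rfl⟩ := hlift hGa
    rw [hbr, hbr]
    rw [← AddMemClass.coe_add, isTotal_coe, ← smul_add]
    exact half_smul_mem_Tot (skew _ _ hF' hG')
  · obtain ⟨F, hF, hF', rfl⟩ := hlift hFa
    obtain ⟨G, hG, hG', rfl⟩ := hlift hGa
    obtain ⟨K, hK, hK', rfl⟩ := hlift hKa
    simp only [hbr]
    rw [← AddMemClass.coe_add, ← AddMemClass.coe_add, isTotal_coe, ← smul_add, ← smul_add]
    refine half_smul_mem_Tot ?_
    -- An outer bracket with `F` is, modulo total derivatives, the derivative of the inner bracket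
    -- along the Hamiltonian field of `F`.
    have h1 := ev_sub_ip_vd_mem (op (vd F)) (star_half_ip (op (vd G)) (vd K))
    have h2 := ev_sub_ip_vd_mem (op (vd G)) (star_half_ip (op (vd K)) (vd F))
    have h3 := ev_sub_ip_vd_mem (op (vd K)) (star_half_ip (op (vd F)) (vd G))
    have h4 := half_smul_mem_Tot (jacobi _ _ _ hF' hG' hK')
    -- Each linearized gradient occurs twice in the cyclic sum; Helmholtz symmetry trades one
    -- occurrence for the other, leaving the defects.
    have h5 := half_smul_mem_Tot (ip_ev_vd_symm (op (vd F)) (op (vd K)) hG)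
    have h6 := half_smul_mem_Tot (ip_ev_vd_symm (op (vd G)) (op (vd F)) hK)
    have h7 := half_smul_mem_Tot (ip_ev_vd_symm (op (vd K)) (op (vd G)) hF)
    rw [Derivation.map_smul, ev_ip] at h1 h2 h3
    convert (Tot L).sub_mem ((Tot L).sub_mem ((Tot L).sub_mem ((Tot L).sub_mem h4 h5) h6) h7)
      ((Tot L).add_mem ((Tot L).add_mem h1 h2) h3) using 1
    simp only [defect, smul_add, smul_sub]
    ring

/-! ### Symmetries and the domains of `ℋ` and `ℰ` -/

theorem VanishesAtZero.U_mul (f : Loc L) : VanishesAtZero (U * f) := fun _ =>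
  show (0 : ℂ) * _ = 0 from zero_mul _

theorem VanishesAtZero.mul_U (f : Loc L) : VanishesAtZero (f * U) := by
  rw [mul_comm]; exact .U_mul f

theorem VanishesAtZero.iterate_Dt {f : Loc L} (h : VanishesAtZero f) (k : ℕ) :
    VanishesAtZero (VecHier.Dt^[k] f) := by
  induction k with
  | zero => exact h
  | succ k ih => rw [Function.iterate_succ_apply']; exact ih.Dt

theorem VanishesAtZero.ev {v : Loc L} (h : VanishesAtZero v) (f : Loc L) :
    VanishesAtZero (ev v f) := by
  intro x
  rw [VecHier.ev, coe_vfD, vf]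
  have (k : ℕ) : ((VecHier.Dt^[k] v : Loc L) : JetFun) x 0 = 0 := h.iterate_Dt k x
  simp only [this]
  simp

theorem charge_vanishes (f : Loc L) : VanishesAtZero (charge f) := fun x => by
  rw [charge, coe_im, imP]
  change (((U * star f : Loc L) : JetFun) x 0).im = (0 : ℂ)
  rw [VanishesAtZero.U_mul (star f) x]
  simp

theorem two_mul_charge (f : Loc L) : 2 * charge f = -ip (J * U) f := by
  rw [charge, two_mul_im, ip, star_mul, star_mul, star_J, star_star]
  ring

theorem hDom_iff_ip {f : Loc L} : HDom f ↔ ip (J * U) f ∈ Tot L := by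
  rw [← neg_mem_iff, ← two_mul_charge]
  refine ⟨fun h => ?_, mem_Tot_of_two_mul⟩
  rw [two_mul]
  exact (Tot L).add_mem h h

/-- `Im (u f̄)` is, up to a factor, the pairing of `f` with the generator `iu` of phase rotations,
so for a gradient this is Noether's theorem. -/
theorem hDom_vd_iff {F : Loc L} (hF : star F = F) : HDom (vd F) ↔ ev (J * U) F ∈ Tot L := by
  rw [hDom_iff_ip]
  have h := ev_sub_ip_vd_mem (J * U) hF
  exact ⟨fun h' => by simpa using (Tot L).add_mem h h',
    fun h' => by simpa using (Tot L).sub_mem h' h⟩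

/-- The potential is imaginary and drops out of the second charge, which becomes the pairing of `u`
with `D_x f`; integration by parts turns it into the pairing with the translation generator `u_x`.
-/
theorem hDom_J_Hop_vd_iff {F : Loc L} (hF : star F = F) (hd : HDom (vd F)) :
    HDom (J * Hop (vd F)) ↔ ev (Dt U) F ∈ Tot L := by
  have h1 := ev_sub_ip_vd_mem (Dt U) hF
  have h2 := Dt_mem_Tot (ip U (vd F))
  have h3 : ip (J * U) (J * Hop (vd F)) = ip U (Dt (vd F)) := by
    simp only [ip, Hop, star_mul, star_J, star_sub, star_pot hd]
    linear_combination (-(U * star (Dt (vd F))) - star U * Dt (vd F)) * J_mul_J (L := L)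
  rw [Dt_ip] at h2
  rw [hDom_iff_ip, h3]
  refine ⟨fun h => ?_, fun h => ?_⟩
  · convert (Tot L).sub_mem ((Tot L).add_mem h1 h2) h using 1; ring
  · convert (Tot L).sub_mem ((Tot L).add_mem h1 h2) h using 1; ring

/-- Equivariance under the phase rotations `u ↦ e^{iθ} u`. -/
def Equivariant (f : Loc L) : Prop := ev (J * U) f = J * f

/-- Invariance under the translations in `x`. -/
def TransInv (f : Loc L) : Prop := ev (Dt U) f = Dt f

/-- Differentiate the invariance of the functional along an arbitrary `w`, apply Helmholtz symmetry,
and use nondegeneracy. -/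
theorem equivariant_vd {F : Loc L} (hF : star F = F) (hd : HDom (vd F)) : Equivariant (vd F) := by
  refine eq_of_ip_sub_mem_Tot fun w => ?_
  have h1 := ip_ev_vd_symm (J * U) w hF
  have h2 := ev_mem_Tot w (hDom_iff_ip.1 hd)
  rw [ev_ip, Derivation.leibniz, derivation_J, ev_U] at h2
  convert (Tot L).add_mem h1 h2 using 1
  simp only [ip, star_mul, star_J, smul_eq_mul, mul_zero, add_zero]
  ring

theorem transInv_vd {F : Loc L} (hF : star F = F) (hd : HDom (vd F))
    (hd' : HDom (J * Hop (vd F))) : TransInv (vd F) := by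
  refine eq_of_ip_sub_mem_Tot fun w => ?_
  have h1 := ip_ev_vd_symm (Dt U) w hF
  have h2 := ev_sub_ip_vd_mem (Dt U) hF
  have h3 := (Tot L).sub_mem ((hDom_J_Hop_vd_iff hF hd).1 hd') h2
  rw [sub_sub_cancel] at h3
  have h4 := ev_mem_Tot w h3
  rw [ev_ip, ev_Dt, ev_U] at h4
  have h5 := Dt_mem_Tot (ip w (vd F))
  rw [Dt_ip] at h5
  convert (Tot L).sub_mem ((Tot L).add_mem h1 h4) h5 using 1
  ring

theorem Equivariant.J_mul {f : Loc L} (h : Equivariant f) : Equivariant (J * f) := by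
  rw [Equivariant, Derivation.leibniz, derivation_J, h, smul_zero, add_zero, smul_eq_mul]

theorem Equivariant.const_mul {f : Loc L} (h : Equivariant f) (c : ℂ) : Equivariant (c • f) := by
  rw [Equivariant, Derivation.map_smul, h, mul_smul_comm]

theorem Equivariant.add {f g : Loc L} (hf : Equivariant f) (hg : Equivariant g) :
    Equivariant (f + g) := by
  rw [Equivariant, map_add, hf, hg, mul_add]

theorem Equivariant.hop {f : Loc L} (h : Equivariant f) (hd : HDom f) : Equivariant (Hop f) := by
  have h' : ev (J * U) f = J * f := h
  have h1 : ev (J * U) (pot f) = 0 := by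
    -- The rotation field vanishes at the zero jet, which fixes the constant of integration.
    refine eq_of_Dt_eq ?_ (VanishesAtZero.ev (.mul_U J) _ 0)
    have h2 := congrArg (ev (J * U)) (two_Dt_pot hd)
    simp only [map_sub, Derivation.leibniz, ev_star, smul_eq_mul, derivation_two, ev_U, ev_Dt,
      h', star_mul, star_J] at h2
    rw [map_zero]
    refine eq_zero_of_two_mul ?_
    linear_combination h2
  rw [Equivariant, Hop, map_sub, Derivation.leibniz, h1, ev_Dt, h, ev_U, Derivation.leibniz,
    derivation_J]
  simp only [smul_eq_mul, mul_zero, add_zero, zero_add]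
  ring

theorem TransInv.J_mul {f : Loc L} (h : TransInv f) : TransInv (J * f) := by
  rw [TransInv, Derivation.leibniz, Derivation.leibniz, derivation_J, derivation_J, h]

theorem TransInv.const_mul {f : Loc L} (h : TransInv f) (c : ℂ) : TransInv (c • f) := by
  rw [TransInv, Derivation.map_smul, Derivation.map_smul, h]

theorem TransInv.add {f g : Loc L} (hf : TransInv f) (hg : TransInv g) : TransInv (f + g) := by
  rw [TransInv, map_add, map_add, hf, hg]

theorem TransInv.sub {f g : Loc L} (hf : TransInv f) (hg : TransInv g) : TransInv (f - g) := by
  rw [TransInv, map_sub, map_sub, hf, hg]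

theorem TransInv.mul {f g : Loc L} (hf : TransInv f) (hg : TransInv g) : TransInv (f * g) := by
  rw [TransInv, Derivation.leibniz, Derivation.leibniz, hf, hg]

theorem TransInv.star {f : Loc L} (hf : TransInv f) : TransInv (star f) := by
  rw [TransInv, ev_star, Dt_star, hf]

theorem TransInv.Dt {f : Loc L} (hf : TransInv f) : TransInv (Dt f) := by
  rw [TransInv, ev_Dt, hf]

theorem TransInv.U : TransInv (U : Loc L) := ev_U _

theorem TransInv.di {f : Loc L} (h : TransInv f) (hf : f ∈ Tot L) (h0 : VanishesAtZero f) :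
    TransInv (di f) := by
  refine eq_of_Dt_eq ?_ ?_
  · rw [← ev_Dt, Dt_di hf, h]
  -- Translations move the base point `x = 0`, so normalization there is preserved only because `f`
  -- vanishes on the zero jet.
  · rw [Dt_di hf, h0]
    exact VanishesAtZero.ev (VanishesAtZero.Dt (f := VecHier.U) fun _ => rfl) _ 0

theorem TransInv.hop {f : Loc L} (h : TransInv f) (hd : HDom f) : TransInv (Hop f) := by
  have hc : TransInv (charge f) :=
    .const_mul (.sub (.star (.mul .U h.star)) (.mul .U h.star)) _
  exact .sub h.Dt (.mul .U (.J_mul (hc.di hd (charge_vanishes f))))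

/-! ### Real linear combinations of `ℰ`, `ℋ`, `ℐ` -/

section
variable (a b c : ℝ)

/-- `a ℰ + b ℋ + c ℐ`. -/
def lin (f : Loc L) : Loc L :=
  (a : ℂ) • Eop f + (b : ℂ) • Hop f + (c : ℂ) • (-Complex.I) • f

theorem lin_eq (f : Loc L) : lin a b c f = algebraMap ℂ (Loc L) a * Eop f +
    algebraMap ℂ (Loc L) b * Hop f - algebraMap ℂ (Loc L) c * (J * f) := by
  rw [lin, neg_smul, smul_neg, J_smul, Algebra.smul_def, Algebra.smul_def, Algebra.smul_def,
    sub_eq_add_neg]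

theorem star_algebraMap_real : star (algebraMap ℂ (Loc L) (a : ℂ)) = algebraMap ℂ (Loc L) a := by
  rw [← algebraMap_star_comm]
  simp

theorem skew_lin {f g : Loc L} (hE : a = 0 ∨ EDom f ∧ EDom g) (hf : HDom f) (hg : HDom g) :
    ip (lin a b c f) g + ip (lin a b c g) f ∈ Tot L := by
  have h1 := (Tot L).smul_mem (b : ℂ) (ip_Hop_add f g hf hg)
  have h2 : (a : ℂ) • (ip (Eop f) g + ip (Eop g) f) ∈ Tot L := by
    rcases hE with rfl | ⟨hEf, hEg⟩
    · simp
    · refine (Tot L).smul_mem _ ?_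
      -- Skewness of `ℋ J ℋ` is skewness of `ℋ` used twice; the middle terms cancel because `J` is
      -- skew.
      have h3 := ip_Hop_add (J * Hop f) g hEf.2 hg
      have h4 := ip_Hop_add (J * Hop g) f hEg.2 hf
      convert (Tot L).add_mem h3 h4 using 1
      simp only [ip, Eop, star_mul, star_J]
      ring
  convert (Tot L).add_mem h2 h1 using 1
  rw [lin_eq, lin_eq]
  simp only [ip, star_sub, star_add, star_mul, star_J, star_algebraMap_real, Algebra.smul_def]
  ring

/-- The constant skew operator `ℐ` has no defect; `c` enters the Jacobi identity only through the
direction `v`. -/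
theorem defect_lin (v g k : Loc L) : defect (lin a b c) v g k =
    (a : ℂ) • defect Eop v g k + (b : ℂ) • defect Hop v g k := by
  simp only [defect, lin_eq, ip, map_add, map_sub, Derivation.leibniz, Derivation.map_algebraMap,
    derivation_J, star_sub, star_add, star_mul, star_J, star_algebraMap_real, smul_eq_mul,
    mul_zero, add_zero]
  simp only [Algebra.smul_def]
  ring

theorem ip_J_mul_left (e k : Loc L) : ip (J * e) k = -(J * wd e k) := by
  simp only [ip, wd, star_mul, star_J]; ring

theorem wd_J_mul_left (e k : Loc L) : wd (J * e) k = -(J * ip e k) := by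
  simp only [ip, wd, star_mul, star_J]; ring

theorem ip_combination (x y w e : Loc L) : ip (algebraMap ℂ (Loc L) a * x +
    algebraMap ℂ (Loc L) b * y - algebraMap ℂ (Loc L) c * w) e = algebraMap ℂ (Loc L) a * ip x e +
    algebraMap ℂ (Loc L) b * ip y e - algebraMap ℂ (Loc L) c * ip w e := by
  simp only [ip, star_sub, star_add, star_mul, star_algebraMap_real]; ring

theorem wd_combination (x y w e : Loc L) : wd (algebraMap ℂ (Loc L) a * x +
    algebraMap ℂ (Loc L) b * y - algebraMap ℂ (Loc L) c * w) e = algebraMap ℂ (Loc L) a * wd x e +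
    algebraMap ℂ (Loc L) b * wd y e - algebraMap ℂ (Loc L) c * wd w e := by
  simp only [wd, star_sub, star_add, star_mul, star_algebraMap_real]; ring

theorem wd_lin (f k : Loc L) : wd (lin a b c f) k = -((a : ℂ) • (J * ip (eps f) k)) +
    (b : ℂ) • wd (Hop f) k + (c : ℂ) • (J * ip f k) := by
  rw [lin_eq, Eop_eq, wd_combination, wd_J_mul_left, wd_J_mul_left]
  simp only [Algebra.smul_def]
  ring

theorem ip_lin (f k : Loc L) : ip (lin a b c f) k = -((a : ℂ) • (J * wd (eps f) k)) +
    (b : ℂ) • ip (Hop f) k + (c : ℂ) • (J * wd f k) := by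
  rw [lin_eq, Eop_eq, ip_combination, ip_J_mul_left, ip_J_mul_left]
  simp only [Algebra.smul_def]
  ring

theorem defect_lin_E {f g k : Loc L} (hg : EDom g) (hk : EDom k) :
    defect (lin a b c) (lin a b c f) g k -
      ((a * a : ℂ) • (potE g * ip (eps f) k - potE k * ip (eps f) g + pot g * wd (eps f) (Hop k)
          - pot k * wd (eps f) (Hop g)) +
        (a * b : ℂ) • (J * (potE g * wd (Hop f) k - potE k * wd (Hop f) g
          + pot g * ip (Hop f) (Hop k) - pot k * ip (Hop f) (Hop g)
          - (pot g * ip (eps f) k - pot k * ip (eps f) g))) -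
        (a * c : ℂ) • (potE g * ip f k - potE k * ip f g + pot g * wd f (Hop k)
          - pot k * wd f (Hop g)) +
        (b * b : ℂ) • (pot g * wd (Hop f) k - pot k * wd (Hop f) g) +
        (b * c : ℂ) • (J * (pot g * ip f k - pot k * ip f g))) ∈ Tot L := by
  have h1 := (Tot L).smul_mem (a : ℂ) (defect_Eop (lin a b c f) hg hk)
  have h2 := (Tot L).smul_mem (b : ℂ) (defect_Hop (lin a b c f) hg.1 hk.1)
  rw [defect_lin]
  convert (Tot L).add_mem h1 h2 using 1
  rw [wd_lin, wd_lin, ip_lin, ip_lin]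
  simp only [Algebra.smul_def, map_mul]
  set A := algebraMap ℂ (Loc L) a
  set C := algebraMap ℂ (Loc L) c
  linear_combination (C * A * (potE g * ip f k - potE k * ip f g + pot g * wd f (Hop k)
          - pot k * wd f (Hop g)) - A * A * (potE g * ip (eps f) k - potE k * ip (eps f) g
          + pot g * wd (eps f) (Hop k) - pot k * wd (eps f) (Hop g))) * J_mul_J (L := L)

theorem defect_lin_H {f g k : Loc L} (hg : HDom g) (hk : HDom k) :
    defect (lin 0 b c) (lin 0 b c f) g k -
      ((b * b : ℂ) • (pot g * wd (Hop f) k - pot k * wd (Hop f) g) +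
        (b * c : ℂ) • (J * (pot g * ip f k - pot k * ip f g))) ∈ Tot L := by
  have h2 := (Tot L).smul_mem (b : ℂ) (defect_Hop (lin 0 b c f) hg hk)
  rw [defect_lin]
  convert h2 using 1
  rw [wd_lin, wd_lin]
  simp only [Algebra.smul_def, map_mul, Complex.ofReal_zero, map_zero]
  ring

theorem cyclic_HI (f g k : Loc L) : (pot g * ip f k - pot k * ip f g) +
    (pot k * ip g f - pot f * ip g k) + (pot f * ip k g - pot g * ip k f) = 0 := by
  simp only [ip]; ring

theorem jacobi_lin_E {f g k : Loc L} (hf : EDom f) (hg : EDom g) (hk : EDom k) :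
    defect (lin a b c) (lin a b c f) g k + defect (lin a b c) (lin a b c g) k f +
      defect (lin a b c) (lin a b c k) f g ∈ Tot L := by
  have h1 := (Tot L).add_mem ((Tot L).add_mem (defect_lin_E a b c (f := f) hg hk)
    (defect_lin_E a b c (f := g) hk hf)) (defect_lin_E a b c (f := k) hf hg)
  have h2 := (Tot L).smul_mem (a * a : ℂ) (cyclic_EE hf hg hk)
  have h3 := (Tot L).smul_mem (a * b : ℂ) (J_mul_mem_Tot (cyclic_EH hf hg hk))
  have h4 := (Tot L).smul_mem (a * c : ℂ) (cyclic_EI hf hg hk)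
  have h5 := (Tot L).smul_mem (b * b : ℂ) (cyclic_HH hf.1 hg.1 hk.1)
  convert (Tot L).add_mem ((Tot L).sub_mem ((Tot L).add_mem ((Tot L).add_mem h1 h2) h3) h4) h5
    using 1
  simp only [Algebra.smul_def]
  linear_combination algebraMap ℂ (Loc L) (b * c) * J * cyclic_HI f g k

theorem jacobi_lin_H {f g k : Loc L} (hf : HDom f) (hg : HDom g) (hk : HDom k) :
    defect (lin 0 b c) (lin 0 b c f) g k + defect (lin 0 b c) (lin 0 b c g) k f +
      defect (lin 0 b c) (lin 0 b c k) f g ∈ Tot L := by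
  have h1 := (Tot L).add_mem ((Tot L).add_mem (defect_lin_H b c (f := f) hg hk)
    (defect_lin_H b c (f := g) hk hf)) (defect_lin_H b c (f := k) hf hg)
  have h5 := (Tot L).smul_mem (b * b : ℂ) (cyclic_HH hf hg hk)
  convert (Tot L).add_mem h1 h5 using 1
  simp only [Algebra.smul_def]
  linear_combination algebraMap ℂ (Loc L) (b * c) * J * cyclic_HI f g k

end

/-- A simultaneous phase rotation of `f` and `g` preserves `Re (f ḡ)`, so the bracket density is
itself phase invariant. -/
theorem hDom_vd_bracket {P f g : Loc L} (hf : Equivariant f) (hg : Equivariant g)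
    (hP : P = (1 / 2 : ℂ) • ip f g) : HDom (vd P) := by
  subst hP
  rw [hDom_vd_iff (star_half_ip _ _), Derivation.map_smul, ev_ip, hf, hg]
  convert (Tot L).zero_mem using 1
  simp only [ip, star_mul, star_J]
  rw [smul_eq_zero]
  right
  ring

theorem eDom_vd_bracket {P f g : Loc L} (hf : Equivariant f) (hg : Equivariant g)
    (hf' : TransInv f) (hg' : TransInv g)
    (hP : P = (1 / 2 : ℂ) • ip f g) : EDom (vd P) := by
  have h1 := hDom_vd_bracket hf hg hP
  refine ⟨h1, ?_⟩
  subst hP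
  rw [hDom_J_Hop_vd_iff (star_half_ip _ _) h1, Derivation.map_smul, ev_ip, hf', hg', ← Dt_ip]
  exact half_smul_mem_Tot (Dt_mem_Tot _)

theorem Equivariant.lin_E (a b c : ℝ) {f : Loc L} (h : Equivariant f) (hd : EDom f) :
    Equivariant (lin a b c f) :=
  (((h.hop hd.1).J_mul.hop hd.2).const_mul _ |>.add ((h.hop hd.1).const_mul _)).add
    ((h.const_mul _).const_mul _)

theorem Equivariant.lin_H (b c : ℝ) {f : Loc L} (h : Equivariant f) (hd : HDom f) :
    Equivariant (lin 0 b c f) := by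
  rw [lin, Complex.ofReal_zero, zero_smul, zero_add]
  exact ((h.hop hd).const_mul _).add ((h.const_mul _).const_mul _)

theorem TransInv.lin_E (a b c : ℝ) {f : Loc L} (h : TransInv f) (hd : EDom f) :
    TransInv (lin a b c f) :=
  (((h.hop hd.1).J_mul.hop hd.2).const_mul _ |>.add ((h.hop hd.1).const_mul _)).add
    ((h.const_mul _).const_mul _)

theorem dom_opE {f : Loc L} : (opE L).dom f ↔ EDom f := by
  change (opH L).dom f ∧ IsLocal L ((opH L).op f) ∧ (opH L).dom (Complex.I • (opH L).op f) ↔ _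
  rw [dom_opH, ← coe_Hop, EDom, ← dom_opH (f := J * Hop f), ← J_smul]
  exact and_congr_right fun _ => and_iff_right (Hop f).2

theorem coe_Eop (f : Loc L) : (Eop f : JetFun) = (opE L).op f := by
  change _ = (opH L).op (Complex.I • (opH L).op f)
  rw [← coe_Hop, Eop, coe_Hop, ← J_smul]
  rfl

theorem isHamiltonian_opI : IsHamiltonian L (opI L) := by
  refine isHamiltonian_of (dom := fun _ => True) (op := fun f => -Complex.I • f)
    (fun f => iff_true_intro f.2) (fun f => rfl) ?_ ?_ fun _ _ _ _ _ _ => trivial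
  · intro f g _ _
    convert (Tot L).zero_mem using 1
    simp only [ip, neg_smul, J_smul, star_neg, star_mul, star_J]
    ring
  · intro f g k _ _ _
    convert (Tot L).zero_mem using 1
    have (v g k : Loc L) : defect (fun f => -Complex.I • f) v g k = 0 := by
      simp only [defect, ip, neg_smul, J_smul, star_neg, star_mul, star_J, map_neg,
        Derivation.leibniz, derivation_J, mul_zero, add_zero, smul_eq_mul]
      ring
    simp only [this, add_zero]

theorem isHamiltonian_opH_opI (b c : ℝ) :
    IsHamiltonian L (((opH L).smul b).add ((opI L).smul c)) := by
  refine isHamiltonian_of (dom := HDom) (op := lin 0 b c) (fun f => ?_) (fun f => ?_)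
    (fun f g hf hg => skew_lin 0 b c (.inl rfl) hf hg)
    (fun f g k hf hg hk => jacobi_lin_H b c hf hg hk)
    (fun F G hF hG hdF hdG => hDom_vd_bracket ((equivariant_vd hF hdF).lin_H b c hdF)
      (equivariant_vd hG hdG) rfl)
  · exact (and_iff_left f.2).trans dom_opH
  · rw [lin, Complex.ofReal_zero, zero_smul, zero_add]
    change (b : ℂ) • (Hop f : JetFun) + _ = _
    rw [coe_Hop]
    rfl

theorem isHamiltonian_opE_opH_opI (a b c : ℝ) : IsHamiltonian L
    ((((opE L).smul a).add ((opH L).smul b)).add ((opI L).smul c)) := by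
  refine isHamiltonian_of (dom := EDom) (op := lin a b c) (fun f => ?_) (fun f => ?_)
    (fun f g hf hg => skew_lin a b c (.inr ⟨hf, hg⟩) hf.1 hg.1)
    (fun f g k hf hg hk => jacobi_lin_E a b c hf hg hk)
    (fun F G hF hG hdF hdG => eDom_vd_bracket ((equivariant_vd hF hdF.1).lin_E a b c hdF)
      (equivariant_vd hG hdG.1) ((transInv_vd hF hdF.1 hdF.2).lin_E a b c hdF)
      (transInv_vd hG hdG.1 hdG.2) rfl)
  · change ((opE L).dom f ∧ (opH L).dom f) ∧ IsLocal L f ↔ _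
    rw [dom_opE, dom_opH]
    exact ⟨fun h => h.1.1, fun h => ⟨⟨h, h.1⟩, f.2⟩⟩
  · change (a : ℂ) • (Eop f : JetFun) + (b : ℂ) • (Hop f : JetFun) + _ = _
    rw [coe_Hop, coe_Eop]
    rfl

theorem JetOp.ext' {A B : JetOp} (h1 : ∀ f, A.dom f ↔ B.dom f) (h2 : ∀ f, A.op f = B.op f) :
    A = B := by
  cases A; cases B
  congr
  · exact funext fun f => propext (h1 f)
  · exact funext h2

theorem isHamiltonian_opH : IsHamiltonian L (opH L) := by
  convert isHamiltonian_opH_opI (L := L) 1 0 using 1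
  refine JetOp.ext' (fun f => ?_) fun f => ?_
  · exact (and_iff_left_of_imp fun h => h.1).symm
  · simp [JetOp.add, JetOp.smul]

theorem isHamiltonian_opE : IsHamiltonian L (opE L) := by
  convert isHamiltonian_opE_opH_opI (L := L) 1 0 0 using 1
  refine JetOp.ext' (fun f => ?_) fun f => ?_
  · change (opE L).dom f ↔ ((opE L).dom f ∧ (opH L).dom f) ∧ IsLocal L f
    exact ⟨fun h => ⟨⟨h, h.1⟩, h.1.1⟩, fun h => h.1.1⟩
  · simp [JetOp.add, JetOp.smul]

/-! ### The recursion sequence -/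

/-- The sequence `(iℋ)^n u`. -/
def fn (L : ℝ) (n : ℕ) : Loc L := (fun f => J * Hop f)^[n] U

theorem fn_zero : fn L 0 = U := rfl

theorem fn_succ (n : ℕ) : fn L (n + 1) = J * Hop (fn L n) := Function.iterate_succ_apply' _ _ _

theorem coe_fn (n : ℕ) : (fn L n : JetFun) = (iH L)^[n] u := by
  induction n with
  | zero => rfl
  | succ n ih =>
    rw [fn_succ, Function.iterate_succ_apply', ← ih, iH, ← coe_Hop, ← J_smul]
    rfl

theorem hDom_iff_wd {f : Loc L} : HDom f ↔ wd U f ∈ Tot L := by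
  have h : ip (J * U) f = -(J * wd U f) := ip_J_mul_left _ _
  rw [hDom_iff_ip, h, neg_mem_iff]
  refine ⟨fun h => ?_, J_mul_mem_Tot⟩
  convert (Tot L).neg_mem (J_mul_mem_Tot h) using 1
  linear_combination wd U f * J_mul_J (L := L)

theorem wd_fn_shift {j k : ℕ} (hj : HDom (fn L j)) (hk : HDom (fn L k)) :
    wd (fn L j) (fn L (k + 1)) - wd (fn L (j + 1)) (fn L k) ∈ Tot L := by
  convert J_mul_mem_Tot (ip_Hop_add _ _ hk hj) using 1
  rw [fn_succ, fn_succ]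
  simp only [wd, ip, star_mul, star_J]
  ring

/-- Shift the index from the first factor to the second one unit at a time. Each shift uses only
terms of index below `N`, as the induction for `hDom_fn` requires. -/
theorem wd_fn_mem_of {N : ℕ} (h : ∀ m < N, HDom (fn L m)) (j k : ℕ) (hjk : j + k ≤ N) :
    wd (fn L j) (fn L k) - wd (fn L 0) (fn L (j + k)) ∈ Tot L := by
  induction j generalizing k with
  | zero => simp
  | succ j ih =>
    convert (Tot L).sub_mem (ih (k + 1) (by omega))
      (wd_fn_shift (h j (by omega)) (h k (by omega))) using 1
    rw [show j + 1 + k = j + (k + 1) by omega]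
    ring

theorem hDom_fn (n : ℕ) : HDom (fn L n) := by
  induction n using Nat.strong_induction_on with
  | _ n ih =>
    rw [hDom_iff_wd]
    -- Shifting all the way exchanges `f_n` and `u`; by antisymmetry of `wd` the difference is `-2
    -- wd u f_n`.
    have h := wd_fn_mem_of ih n 0 le_rfl
    refine mem_Tot_of_two_mul ?_
    rw [← neg_mem_iff]
    convert h using 1
    simp only [wd, fn_zero, add_zero]
    ring

theorem wd_fn_mem (j k : ℕ) : wd (fn L j) (fn L k) ∈ Tot L := by
  have h := wd_fn_mem_of (N := j + k) (fun m _ => hDom_fn (L := L) m) j k le_rfl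
  have h' : wd (fn L 0) (fn L (j + k)) ∈ Tot L := hDom_iff_wd.1 (hDom_fn (j + k))
  simpa using (Tot L).add_mem h h'

/-- The potentials `D_x⁻¹ Im(u f̄_n)` of `f_n = (iℋ)^n u`. -/
def qn (L : ℝ) (n : ℕ) : Loc L := di (charge (fn L n))

theorem fn_succ' (n : ℕ) : fn L (n + 1) = J * Dt (fn L n) + U * qn L n := by
  rw [fn_succ, Hop, pot]
  change J * (Dt (fn L n) - U * (J * qn L n)) = _
  linear_combination -(U * qn L n) * J_mul_J (L := L)

theorem star_qn (n : ℕ) : star (qn L n) = qn L n := star_di (hDom_fn n) (star_im _)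

theorem two_Dt_qn (n : ℕ) : 2 * Dt (qn L n) = J * (star U * fn L n - U * star (fn L n)) := by
  rw [qn, Dt_di (hDom_fn n), charge, two_mul_im, star_mul, star_star]
  ring

theorem qn_vanishes (n : ℕ) : VanishesAtZero (qn L n) := (charge_vanishes _).di (hDom_fn n)

theorem qn_zero : qn L 0 = 0 :=
  di_eq (by
    rw [map_zero]
    refine (eq_zero_of_two_mul ?_).symm
    rw [charge, two_mul_im, fn_zero, star_mul, star_star]
    ring) rfl

theorem fn_vanishes (n : ℕ) : VanishesAtZero (fn L n) := by
  induction n with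
  | zero => exact fun _ => rfl
  | succ n ih =>
    intro x
    rw [fn_succ']
    change Complex.I * (Dt (fn L n) : JetFun) x 0 + 0 * (qn L n : JetFun) x 0 = 0
    rw [ih.Dt x]
    simp

/-! ### Generating functions and the trace identity -/

section PowerSeries
open PowerSeries

/-- Coefficientwise application of a map to a power series. -/
def cw (d : Loc L → Loc L) (F : PowerSeries (Loc L)) : PowerSeries (Loc L) :=
  PowerSeries.mk fun n => d (coeff n F)

variable (d : Derivation ℂ (Loc L) (Loc L))

theorem coeff_cw (d : Loc L → Loc L) (n : ℕ) (F : PowerSeries (Loc L)) :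
    coeff n (cw d F) = d (coeff n F) := coeff_mk _ _

theorem cw_add (F G : PowerSeries (Loc L)) : cw d (F + G) = cw d F + cw d G := by
  ext1 n; simp [coeff_cw]

theorem cw_sub (F G : PowerSeries (Loc L)) : cw d (F - G) = cw d F - cw d G := by
  ext1 n; simp [coeff_cw]

theorem cw_mul (F G : PowerSeries (Loc L)) : cw d (F * G) = cw d F * G + F * cw d G := by
  ext1 n
  simp only [coeff_cw, coeff_mul, map_sum, Derivation.leibniz, map_add, smul_eq_mul,
    ← Finset.sum_add_distrib]
  exact Finset.sum_congr rfl fun p _ => by ring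

theorem cw_neg (F : PowerSeries (Loc L)) : cw d (-F) = -cw d F := by
  ext1 n; simp [coeff_cw]

theorem cw_C (a : Loc L) : cw d (C a) = C (d a) := by
  ext1 n
  simp only [coeff_cw, coeff_C]
  split_ifs <;> simp

theorem cw_one : cw d 1 = 0 := by
  rw [← map_one C, cw_C, Derivation.map_one_eq_zero, map_zero]

theorem cw_X : cw d X = 0 := by
  ext1 n
  simp only [coeff_cw, coeff_X]
  split_ifs <;> simp

theorem cw_derivative (F : PowerSeries (Loc L)) :
    cw d (d⁄dX (Loc L) F) = d⁄dX (Loc L) (cw d F) := by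
  ext1 n
  simp only [coeff_cw, coeff_derivative, Derivation.leibniz, smul_eq_mul]
  rw [show ((n : Loc L) + 1) = algebraMap ℂ (Loc L) (n + 1) by simp, Derivation.map_algebraMap]
  ring

theorem cw_comm (v : Loc L) (F : PowerSeries (Loc L)) :
    cw Dt (cw (ev v) F) = cw (ev v) (cw Dt F) := by
  ext1 n; simp only [coeff_cw, ev_Dt]

/-- The generating function `∑ f_n s^{n+1}`. -/
def genF (L : ℝ) : PowerSeries (Loc L) := X * PowerSeries.mk (fn L)

/-- The generating function `∑ f̄_n s^{n+1}`. -/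
def genFb (L : ℝ) : PowerSeries (Loc L) := X * PowerSeries.mk fun n => star (fn L n)

/-- The generating function `1 + ∑ q_n s^{n+1}`. -/
def genQ (L : ℝ) : PowerSeries (Loc L) := 1 + X * PowerSeries.mk (qn L)

theorem X_mul_cw_genF : X * cw Dt (genF L) = -C J * genF L + C J * C U * genQ L * X := by
  have h : PowerSeries.mk (fn L) = X * (C J * cw Dt (PowerSeries.mk (fn L))) + C U * genQ L := by
    ext1 n
    cases n with
    | zero => simp [genQ, fn_zero]
    | succ n =>
      simp [genQ, coeff_succ_X_mul, coeff_cw, fn_succ', mul_add]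
  have hJ : (C J * C J : PowerSeries (Loc L)) = -1 := by rw [← map_mul, J_mul_J]; simp
  rw [genF, cw_mul, cw_X]
  linear_combination X * C J * h + X ^ 2 * cw Dt (PowerSeries.mk (fn L)) * hJ

theorem X_mul_cw_genFb :
    X * cw Dt (genFb L) = C J * genFb L - C J * C (star U) * genQ L * X := by
  have h : (PowerSeries.mk fun n => star (fn L n)) +
      X * (C J * cw Dt (PowerSeries.mk fun n => star (fn L n))) = C (star U) * genQ L := by
    ext1 n
    cases n with
    | zero => simp [genQ, fn_zero]
    | succ n =>
      simp [genQ, coeff_succ_X_mul, coeff_cw, fn_succ', coeff_one, star_J, Dt_star, star_qn]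
      ring
  have hJ : (C J * C J : PowerSeries (Loc L)) = -1 := by rw [← map_mul, J_mul_J]; simp
  rw [genFb, cw_mul, cw_X]
  linear_combination (-X * C J) * h +
    X ^ 2 * cw Dt (PowerSeries.mk fun n => star (fn L n)) * hJ

theorem two_cw_genQ : 2 * cw Dt (genQ L) = C J * (C (star U) * genF L - C U * genFb L) := by
  have h : 2 * cw Dt (PowerSeries.mk (qn L)) = C J * (C (star U) * PowerSeries.mk (fn L) -
      C U * PowerSeries.mk fun n => star (fn L n)) := by
    ext1 n
    rw [two_mul, map_add, coeff_cw, coeff_mk, ← two_mul, two_Dt_qn]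
    simp
  rw [genF, genFb, genQ, cw_add, cw_mul, cw_X, cw_one]
  linear_combination X * h

/-- The generating functions form a unit vector. -/
theorem genQ_sq_add : genQ L ^ 2 + genF L * genFb L = 1 := by
  have hD : cw Dt (genQ L ^ 2 + genF L * genFb L - 1) = 0 := by
    have hX : X * cw Dt (genQ L ^ 2 + genF L * genFb L - 1) = 0 := by
      rw [cw_sub, cw_add, pow_two, cw_mul, cw_mul, cw_one]
      linear_combination genFb L * X_mul_cw_genF (L := L) + genF L * X_mul_cw_genFb (L := L) +
        X * genQ L * two_cw_genQ (L := L)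
    ext1 n
    have := congrArg (coeff (n + 1)) hX
    rwa [coeff_succ_X_mul] at this
  let e : Loc L →+* ℂ :=
    { toFun := fun f => (f : JetFun) 0 0
      map_one' := rfl
      map_mul' := fun _ _ => rfl
      map_zero' := rfl
      map_add' := fun _ _ => rfl }
  -- The length is constant; at the zero jet all `f_n` and `q_n` vanish, so `V = (1, 0)` there.
  have he : PowerSeries.map e (genQ L ^ 2 + genF L * genFb L - 1) = 0 := by
    have hF : PowerSeries.map e (genF L) = 0 := by
      ext1 n
      rw [genF, map_mul, map_X]
      cases n with
      | zero => simp
      | succ n =>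
        simp only [coeff_succ_X_mul, coeff_map, coeff_mk, map_zero]
        exact fn_vanishes n 0
    have hQ : PowerSeries.map e (genQ L) = 1 := by
      ext1 n
      rw [genQ, map_add, map_mul, map_X, map_one]
      cases n with
      | zero => simp
      | succ n =>
        simp only [map_add, coeff_succ_X_mul, coeff_map, coeff_mk, coeff_one,
          n.succ_ne_zero, if_false, zero_add]
        exact qn_vanishes n 0
    rw [map_sub, map_add, map_mul, map_pow, hF, hQ, map_one]
    ring
  rw [← sub_eq_zero]
  ext1 n
  refine eq_of_Dt_eq ?_ ?_
  · have := congrArg (coeff n) hD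
    rw [coeff_cw] at this
    simpa using this
  · have := congrArg (coeff n) he
    rwa [coeff_map, map_zero] at this

/-- The variational trace identity: the density `det (V, ∂_w V, ∂_s V)` of the unit vector
`V = (Q, F)` is an antiderivative of the variation of the generating function of the densities. -/
theorem det_identity {R : Type*} [CommRing R]
    {s j a ab w wb Q F Fb Q' F' Fb' Qw Fw Fwb Qw' Fw' Fwb' Qs Fs Fsb Qs' Fs' Fsb' : R}
    (hQ : 2 * Q' = j * (ab * F - a * Fb))
    (hF : s * F' = -j * F + j * a * Q * s) (hFb : s * Fb' = j * Fb - j * ab * Q * s)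
    (hQw : 2 * Qw' = j * (wb * F + ab * Fw - w * Fb - a * Fwb))
    (hFw : s * Fw' = -j * Fw + j * (w * Q + a * Qw) * s)
    (hFwb : s * Fwb' = j * Fwb - j * (wb * Q + ab * Qw) * s)
    (hQs : 2 * Qs' = j * (ab * Fs - a * Fsb))
    (hFs : F' + s * Fs' = -j * Fs + j * a * (Qs * s + Q))
    (hFsb : Fb' + s * Fsb' = j * Fsb - j * ab * (Qs * s + Q))
    (h : Q ^ 2 + F * Fb = 1) (hw : 2 * Q * Qw + F * Fwb + Fw * Fb = 0)
    (hs : 2 * Q * Qs + F * Fsb + Fs * Fb = 0) :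
    s ^ 2 * (2 * (Q' * (Fw * Fsb - Fwb * Fs) + Q * (Fw' * Fsb - Fwb' * Fs + Fw * Fsb' - Fwb * Fs') +
      (Qw' * (Fs * Fb - Fsb * F) + Qw * (Fs' * Fb - Fsb' * F + Fs * Fb' - Fsb * F')) +
      (Qs' * (F * Fwb - Fb * Fw) + Qs * (F' * Fwb - Fb' * Fw + F * Fwb' - Fb * Fw')))) =
    2 * j * (s ^ 2 * (w * Fsb + wb * Fs) + 2 * Qw) := by
  -- Eliminates `F'` by the original equation. The extra term in `F` is the contribution of `∂_s
  -- (1/s)`.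
  have hFs2 : s ^ 2 * Fs' = -j * s * Fs + j * a * Qs * s ^ 2 + j * F := by
    linear_combination s * hFs - hF
  have hFsb2 : s ^ 2 * Fsb' = j * s * Fsb - j * ab * Qs * s ^ 2 - j * Fb := by
    linear_combination s * hFsb - hFb
  linear_combination s ^ 2 * (Fw * Fsb - Fwb * Fs) * hQ + 2 * s * Q * Fsb * hFw -
    2 * s * Q * Fs * hFwb + 2 * Q * Fw * hFsb2 - 2 * Q * Fwb * hFs2 +
    s ^ 2 * (Fs * Fb - Fsb * F) * hQw + 2 * Qw * Fb * hFs2 - 2 * Qw * F * hFsb2 +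
    2 * s * Qw * Fs * hFb - 2 * s * Qw * Fsb * hF + s ^ 2 * (F * Fwb - Fb * Fw) * hQs +
    2 * s * Qs * Fwb * hF - 2 * s * Qs * Fw * hFb + 2 * s * Qs * F * hFwb - 2 * s * Qs * Fb * hFw +
    2 * j * (s ^ 2 * (w * Fsb + wb * Fs) + 2 * Qw) * h - j * s ^ 2 * (F * wb + Fb * w) * hs -
    2 * j * Q * hw

/-- The coefficient of `s^{n+2}` in the trace identity. The factor `n + 1` comes from
differentiating `f_n s^{n+1}`, and accounts for the `1/(1+n)` in the densities. -/
theorem ev_qn_add_ip_mem_Tot (w : Loc L) (n : ℕ) :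
    2 * ev w (qn L (n + 1)) + (n + 1) * ip w (fn L n) ∈ Tot L := by
  have hQw := congrArg (cw (ev w)) (two_cw_genQ (L := L))
  have hFw := congrArg (cw (ev w)) (X_mul_cw_genF (L := L))
  have hFwb := congrArg (cw (ev w)) (X_mul_cw_genFb (L := L))
  have hw := congrArg (cw (ev w)) (genQ_sq_add (L := L))
  have hQs := congrArg (d⁄dX (Loc L)) (two_cw_genQ (L := L))
  have hFs := congrArg (d⁄dX (Loc L)) (X_mul_cw_genF (L := L))
  have hFsb := congrArg (d⁄dX (Loc L)) (X_mul_cw_genFb (L := L))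
  have hs := congrArg (d⁄dX (Loc L)) (genQ_sq_add (L := L))
  simp only [two_mul, pow_two, cw_add, cw_sub, cw_neg, cw_mul, cw_C, cw_X, cw_one, derivation_J,
    ev_star, ev_U, map_zero] at hQw hFw hFwb hw
  simp only [two_mul, pow_two, map_add, map_sub, map_neg, Derivation.leibniz, derivative_C,
    derivative_X, smul_eq_mul, Derivation.map_one_eq_zero] at hQs hFs hFsb hs
  have key := det_identity (w := C w) (wb := C (star w)) (Qw := cw (ev w) (genQ L))
    (Fw := cw (ev w) (genF L)) (Fwb := cw (ev w) (genFb L)) (Qw' := cw (ev w) (cw Dt (genQ L)))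
    (Fw' := cw (ev w) (cw Dt (genF L))) (Fwb' := cw (ev w) (cw Dt (genFb L)))
    (Qs := d⁄dX (Loc L) (genQ L)) (Fs := d⁄dX (Loc L) (genF L)) (Fsb := d⁄dX (Loc L) (genFb L))
    (Qs' := d⁄dX (Loc L) (cw Dt (genQ L))) (Fs' := d⁄dX (Loc L) (cw Dt (genF L)))
    (Fsb' := d⁄dX (Loc L) (cw Dt (genFb L)))
    (two_cw_genQ (L := L)) X_mul_cw_genF X_mul_cw_genFb
    (by linear_combination hQw) (by linear_combination hFw) (by linear_combination hFwb)
    (by linear_combination hQs) (by linear_combination hFs) (by linear_combination hFsb)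
    genQ_sq_add (by linear_combination hw) (by linear_combination hs)
  set Δ := genQ L * (cw (ev w) (genF L) * d⁄dX (Loc L) (genFb L) -
      cw (ev w) (genFb L) * d⁄dX (Loc L) (genF L)) +
    cw (ev w) (genQ L) * (d⁄dX (Loc L) (genF L) * genFb L - d⁄dX (Loc L) (genFb L) * genF L) +
    d⁄dX (Loc L) (genQ L) * (genF L * cw (ev w) (genFb L) - genFb L * cw (ev w) (genF L)) with hΔ
  have key' : X ^ 2 * cw Dt Δ = C J * (X ^ 2 * (C w * d⁄dX (Loc L) (genFb L) +
      C (star w) * d⁄dX (Loc L) (genF L)) + 2 * cw (ev w) (genQ L)) := by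
    -- `det_identity` gives twice the desired equation, so `2` has to be cancelled.
    have h2 (P : PowerSeries (Loc L)) : C (algebraMap ℂ (Loc L) (1 / 2)) * (2 * P) = P := by
      rw [← mul_assoc, ← map_ofNat C 2, ← map_mul, ← map_ofNat (algebraMap ℂ (Loc L)) 2, ← map_mul]
      norm_num
    rw [← h2 (X ^ 2 * _), ← h2 (C J * _)]
    congr 1
    rw [hΔ]
    simp only [cw_add, cw_sub, cw_mul, cw_derivative, cw_comm]
    linear_combination key
  clear_value Δ
  have hc := congrArg (coeff (n + 2)) key'
  rw [coeff_X_pow_mul, coeff_C_mul, map_add, coeff_X_pow_mul, coeff_cw, two_mul, map_add, map_add,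
    coeff_C_mul, coeff_C_mul, coeff_derivative, coeff_derivative, coeff_cw, genF, genFb,
    coeff_succ_X_mul, coeff_succ_X_mul, coeff_mk, coeff_mk] at hc
  have hQ : coeff (n + 2) (genQ L) = qn L (n + 1) := by
    rw [genQ, map_add, coeff_succ_X_mul, coeff_mk, coeff_one, if_neg (by omega), zero_add]
  rw [hQ] at hc
  convert J_mul_mem_Tot (Dt_mem_Tot (-coeff n Δ)) using 1
  rw [map_neg, hc, ip]
  linear_combination (w * star (fn L n) * (n + 1) + star w * fn L n * (n + 1) +
    2 * ev w (qn L (n + 1))) * J_mul_J (L := L)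

end PowerSeries

/-! ### Densities, gradients, flows and independence -/

/-- The density `H^{(n)}`. -/
def dn (L : ℝ) (n : ℕ) : Loc L := (2 / (1 + n) : ℂ) • di (im (star U * fn L (n + 1)))

theorem coe_dn (n : ℕ) : (dn L n : JetFun) = dens L n := by
  change (2 / (1 + n) : ℂ) • Dinv L (im (star U * fn L (n + 1))) = _
  rw [coe_im, dens, ← coe_fn]
  rfl

theorem im_star_U_mul (f : Loc L) : im (star U * f) = -charge f := by
  rw [charge, im, im, ← smul_neg]
  congr 1
  rw [star_mul, star_mul, star_star, star_star]
  ring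

theorem im_star_U_mul_fn_mem (n : ℕ) : im (star U * fn L n) ∈ Tot L := by
  rw [im_star_U_mul]
  exact (Tot L).neg_mem (hDom_fn n)

theorem dn_eq (n : ℕ) : dn L n = -((2 / (1 + n) : ℂ) • qn L (n + 1)) := by
  rw [dn, ← smul_neg, im_star_U_mul]
  congr 1
  refine di_eq (by rw [map_neg, qn, Dt_di (hDom_fn _)]) ?_
  change -((qn L (n + 1) : JetFun) 0 0) = 0
  rw [qn_vanishes, neg_zero]

theorem star_dn (n : ℕ) : star (dn L n) = dn L n := by
  rw [dn_eq, star_neg, star_smul, star_qn]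
  simp

theorem vd_dn (n : ℕ) : vd (dn L n) = fn L n := by
  refine vd_eq_of_ev_sub_mem_Tot (star_dn n) fun w => ?_
  have hn : (1 + n : ℂ) ≠ 0 := by
    rw [add_comm]
    exact Nat.cast_add_one_ne_zero n
  convert (Tot L).smul_mem (-(1 / (1 + n)) : ℂ) (ev_qn_add_ip_mem_Tot w n) using 1
  rw [dn_eq, map_neg, Derivation.map_smul, smul_add,
    show (2 : Loc L) = algebraMap ℂ (Loc L) 2 from (map_ofNat _ 2).symm,
    show ((n : Loc L) + 1) = algebraMap ℂ (Loc L) (n + 1) by simp, ← Algebra.smul_def,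
    ← Algebra.smul_def, smul_smul, smul_smul]
  have h1 : (-(1 / (1 + n)) * 2 : ℂ) = -(2 / (1 + n)) := by ring
  have h2 : (-(1 / (1 + n)) * (n + 1) : ℂ) = -1 := by field_simp; ring
  rw [h1, h2, neg_smul, neg_smul, one_smul, sub_eq_add_neg]

theorem varDeriv_dens (n : ℕ) : varDeriv (dens L n) = fn L n := by
  rw [← coe_dn, ← coe_vd, vd_dn]

theorem Hop_fn (n : ℕ) : Hop (fn L n) = -(J * fn L (n + 1)) := by
  rw [fn_succ]
  linear_combination Hop (fn L n) * J_mul_J (L := L)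

theorem eDom_fn (n : ℕ) : EDom (fn L n) := ⟨hDom_fn n, by rw [← fn_succ]; exact hDom_fn _⟩

theorem coe_Hop_fn (n : ℕ) : (Hop (fn L n) : JetFun) = flow L n := by
  rw [flow, varDeriv_dens, coe_Hop]

theorem ip_J_fn_mem (m n : ℕ) : ip (J * fn L m) (fn L n) ∈ Tot L := by
  rw [ip_J_mul_left]
  exact (Tot L).neg_mem (J_mul_mem_Tot (wd_fn_mem m n))

/-- Hamiltonian flows of functionals in involution commute. -/
theorem ev_comm_of_involution {F G : Loc L} (hF : star F = F) (hG : star G = G)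
    (h : ip (J * vd F) (vd G) ∈ Tot L) :
    ev (-(J * vd F)) (vd G) = ev (-(J * vd G)) (vd F) := by
  refine eq_of_ip_sub_mem_Tot fun w => ?_
  have h1 := ip_ev_vd_symm (-(J * vd F)) w hG
  have h2 := ip_ev_vd_symm (-(J * vd G)) w hF
  have h3 := ev_mem_Tot w h
  rw [ev_ip, Derivation.leibniz, derivation_J, smul_zero, add_zero] at h3
  convert (Tot L).sub_mem ((Tot L).sub_mem h1 h2) h3 using 1
  simp only [ip, smul_eq_mul, star_neg, star_mul, star_J]
  ring

/-- Written through `ℐ`, the flows are constant-coefficient Hamiltonian flows of `H^{(m+1)}` and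
`H^{(n+1)}`, which are in involution. -/
theorem ev_flow_comm (m n : ℕ) :
    ev (Hop (fn L m)) (Hop (fn L n)) = ev (Hop (fn L n)) (Hop (fn L m)) := by
  have h := ev_comm_of_involution (star_dn (L := L) (m + 1)) (star_dn (n + 1))
    (by rw [vd_dn, vd_dn]; exact ip_J_fn_mem _ _)
  rw [vd_dn, vd_dn] at h
  rw [Hop_fn, Hop_fn, map_neg, map_neg, Derivation.leibniz, Derivation.leibniz, h, derivation_J,
    derivation_J, smul_zero, smul_zero]

theorem ev_flow_dn_mem (m n : ℕ) : ev (Hop (fn L n)) (dn L m) ∈ Tot L := by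
  have h1 := ev_sub_ip_vd_mem (Hop (fn L n)) (star_dn (L := L) m)
  have h2 := ip_J_fn_mem (L := L) (n + 1) m
  rw [vd_dn, Hop_fn] at h1
  rw [Hop_fn]
  convert (Tot L).sub_mem h1 h2 using 1
  simp only [ip, star_neg]
  ring

/-- The linear part of `f_n` at the zero jet is `i^n u_n`. -/
theorem pd_fn_zero_jet (n k : ℕ) (x : ℝ) :
    (pd k 1 (fn L n) : JetFun) x 0 = if k = n then Complex.I ^ n else 0 := by
  induction n generalizing k x with
  | zero =>
    rw [fn_zero, U, pd_jet, coe_algebraMap, pow_zero]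
    simp only [eq_comm]
  | succ n ih =>
    have hq := qn_vanishes (L := L) n x
    have hD : (Dt (pd k 1 (fn L n)) : JetFun) x 0 = 0 := by
      rw [coe_Dt_zero_jet, funext (ih k), deriv_const]
    rw [fn_succ', map_add, Derivation.leibniz, Derivation.leibniz, derivation_J]
    -- Both factors of `u q_n` vanish at the zero jet, so this product has no linear part there.
    change Complex.I * (pd k 1 (Dt (fn L n)) : JetFun) x 0 + _ * 0 + (0 * _ +
      (qn L n : JetFun) x 0 * _) = _
    rw [hq, mul_zero, add_zero, zero_mul, zero_mul, add_zero, add_zero]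
    cases k with
    | zero => rw [pd_zero_Dt, hD]; simp
    | succ k =>
      rw [pd_succ_Dt]
      change Complex.I * ((Dt (pd (k + 1) 1 (fn L n)) : JetFun) x 0 +
        (pd k 1 (fn L n) : JetFun) x 0) = _
      rw [hD, ih, zero_add]
      simp only [add_left_inj, mul_ite, mul_zero, pow_succ']

/-- At the zero jet `∂/∂(Re u_i)` annihilates every `f_j` except `f_i`, so it isolates the
coefficient of index `i`. -/
theorem linearIndependent_fn : LinearIndependent ℝ (fun n : ℕ => varDeriv (dens L n)) := by
  rw [linearIndependent_iff']
  intro s g h i hi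
  have h1 : ∑ j ∈ s, (g j : ℂ) • fn L j = 0 := by
    refine Subtype.ext ?_
    rw [AddSubmonoidClass.coe_finsetSum]
    refine Eq.trans (Finset.sum_congr rfl fun j _ => ?_) h
    rw [varDeriv_dens]
    rfl
  have h2 := congrFun (congrFun (congrArg Subtype.val (congrArg (pd i 1) h1)) 0) 0
  rw [map_sum, map_zero, AddSubmonoidClass.coe_finsetSum, Finset.sum_apply, Finset.sum_apply] at h2
  have h3 : ∑ j ∈ s, (g j : ℂ) * (pd i 1 (fn L j) : JetFun) 0 0 = 0 := by
    refine Eq.trans (Finset.sum_congr rfl fun j _ => ?_) h2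
    rw [Derivation.map_smul]
    rfl
  simpa [pd_fn_zero_jet, hi] using h3

/-! ### The NLS and complex mKdV flows -/

theorem qn_eq {n : ℕ} {p : Loc L} (h : 2 * Dt p = J * (star U * fn L n - U * star (fn L n)))
    (h0 : (p : JetFun) 0 0 = 0) : qn L n = p := by
  refine di_eq ?_ h0
  rw [← sub_eq_zero]
  refine eq_zero_of_two_mul ?_
  rw [mul_sub, h, charge, two_mul_im, star_mul, star_star]
  ring

theorem fn_one : fn L 1 = J * jet 1 := by
  rw [fn_succ', qn_zero, fn_zero, U, Dt_jet]
  ring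

theorem two_smul_half (f : Loc L) : 2 * ((-1 / 2 : ℂ) • f) = -f := by
  rw [show (2 : Loc L) = algebraMap ℂ (Loc L) 2 from (map_ofNat _ 2).symm, ← Algebra.smul_def,
    smul_smul]
  norm_num

theorem qn_one : qn L 1 = (-1 / 2 : ℂ) • (U * star U) := by
  refine qn_eq ?_ ?_
  · rw [Derivation.map_smul, two_smul_half, fn_one, Derivation.leibniz, Dt_star, U, Dt_jet,
      star_mul, star_J, smul_eq_mul, smul_eq_mul]
    linear_combination (-(star (jet 0) * jet 1) - jet 0 * star (jet 1)) * J_mul_J (L := L)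
  · change (-1 / 2 : ℂ) * (0 * star 0) = 0
    simp

theorem fn_two : fn L 2 = -jet 2 + (-1 / 2 : ℂ) • (U * (U * star U)) := by
  rw [fn_succ', qn_one, fn_one, Derivation.leibniz, derivation_J, Dt_jet, mul_smul_comm, smul_zero,
    add_zero, smul_eq_mul]
  linear_combination jet 2 * J_mul_J (L := L)

theorem qn_two : qn L 2 = (-1 / 2 : ℂ) • (J * (star U * jet 1 - U * star (jet 1))) := by
  refine qn_eq ?_ ?_
  · have hc : star (algebraMap ℂ (Loc L) (-1 / 2)) = algebraMap ℂ (Loc L) (-1 / 2) := by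
      rw [← algebraMap_star_comm]
      simp
    rw [Derivation.map_smul, two_smul_half, fn_two, Derivation.leibniz, derivation_J, map_sub,
      Derivation.leibniz, Derivation.leibniz, Dt_star, Dt_star, U, Dt_jet, Dt_jet]
    simp only [smul_eq_mul, star_add, star_neg, star_mul, star_star, mul_zero, add_zero,
      Algebra.smul_def, hc]
    ring
  · change (-1 / 2 : ℂ) * (Complex.I * (star 0 * 0 - 0 * star 0)) = 0
    simp

theorem fn_three : fn L 3 = -(J * (jet 3 + (3 / 2 : ℂ) • (U * star U * jet 1))) := by
  rw [fn_succ', qn_two, fn_two, map_add, map_neg, Derivation.map_smul, Derivation.leibniz,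
    Derivation.leibniz, Dt_star, U, Dt_jet, Dt_jet]
  have hc : algebraMap ℂ (Loc L) (3 / 2) = -3 * algebraMap ℂ (Loc L) (-1 / 2) := by
    rw [← map_ofNat (algebraMap ℂ (Loc L)) 3, ← map_neg, ← map_mul]
    norm_num
  simp only [smul_eq_mul, Algebra.smul_def, hc]
  ring

theorem flow_one (x : ℝ) (z : ℕ → ℂ) :
    flow L 1 x z = Complex.I * (z 2 + 1 / 2 * (‖z 0‖ : ℂ) ^ 2 * z 0) := by
  rw [← coe_Hop_fn, Hop_fn, fn_two, ← Complex.mul_conj']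
  change -(Complex.I * (-z 2 + -1 / 2 * (z 0 * (z 0 * star (z 0))))) = _
  rw [Complex.star_def]
  ring

theorem flow_two (x : ℝ) (z : ℕ → ℂ) :
    flow L 2 x z = -(z 3 + 3 / 2 * (‖z 0‖ : ℂ) ^ 2 * z 1) := by
  rw [← coe_Hop_fn, Hop_fn, fn_three, ← Complex.mul_conj']
  change -(Complex.I * -(Complex.I * (z 3 + 3 / 2 * (z 0 * star (z 0) * z 1)))) = _
  rw [Complex.star_def]
  linear_combination (z 3 + 3 / 2 * (z 0 * (starRingEnd ℂ) (z 0) * z 1)) * Complex.I_mul_I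

theorem solves_flow_one (w : ℝ → ℝ → ℂ) : Solves (flow L 1) w ↔
    ∀ t x, -Complex.I * deriv (fun s => w s x) t =
      iteratedDeriv 2 (w t) x + (1 / 2 : ℂ) * (‖w t x‖ : ℂ) ^ 2 * w t x := by
  unfold Solves
  refine forall₂_congr fun t x => ?_
  rw [flow_one, iteratedDeriv_zero]
  refine ⟨fun h => ?_, fun h => ?_⟩
  · rw [h, ← mul_assoc, neg_mul, Complex.I_mul_I, neg_neg, one_mul]
  · rw [← h, ← mul_assoc, mul_neg, Complex.I_mul_I, neg_neg, one_mul]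

theorem solves_flow_two (w : ℝ → ℝ → ℂ) : Solves (flow L 2) w ↔
    ∀ t x, -deriv (fun s => w s x) t =
      iteratedDeriv 3 (w t) x + (3 / 2 : ℂ) * (‖w t x‖ : ℂ) ^ 2 * deriv (w t) x := by
  unfold Solves
  refine forall₂_congr fun t x => ?_
  rw [flow_two, iteratedDeriv_zero, iteratedDeriv_one]
  exact neg_eq_iff_eq_neg.symm

end VecHier

end

theorem mainTheorem5 (L : ℝ) :
    -- `ℋ`, `ℐ`, `ℰ` are Hamiltonian operators; `ℋ`, `ℐ` are compatible,
    -- and `ℰ`, `ℋ`, `ℐ` form a compatible triple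
    (VecHier.IsHamiltonian L (VecHier.opH L) ∧
      VecHier.IsHamiltonian L (VecHier.opI L) ∧
      VecHier.IsHamiltonian L (VecHier.opE L) ∧
      (∀ a b : ℝ, VecHier.IsHamiltonian L
        (((VecHier.opH L).smul a).add ((VecHier.opI L).smul b))) ∧
      (∀ a b c : ℝ, VecHier.IsHamiltonian L
        ((((VecHier.opE L).smul a).add ((VecHier.opH L).smul b)).add
          ((VecHier.opI L).smul c)))) ∧
    -- the densities are well defined, local and real
    (∀ n : ℕ,
      (VecHier.opH L).dom ((VecHier.iH L)^[n] VecHier.u) ∧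
      VecHier.IsTotal L
        (VecHier.imP (star VecHier.u * (VecHier.iH L)^[n + 1] VecHier.u)) ∧
      VecHier.IsLocal L (VecHier.dens L n) ∧ VecHier.IsReal (VecHier.dens L n)) ∧
    -- bi-Hamiltonian form of the `+n` flow
    (∀ n : ℕ,
      (VecHier.opH L).dom (VecHier.varDeriv (VecHier.dens L n)) ∧
      (VecHier.opH L).op (VecHier.varDeriv (VecHier.dens L n)) =
        (VecHier.opI L).op (VecHier.varDeriv (VecHier.dens L (n + 1)))) ∧
    -- third Hamiltonian form of the `+n` flow, `n ≠ 0`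
    (∀ n : ℕ, 1 ≤ n →
      (VecHier.opE L).dom (VecHier.varDeriv (VecHier.dens L (n - 1))) ∧
      VecHier.flow L n = (VecHier.opE L).op (VecHier.varDeriv (VecHier.dens L (n - 1)))) ∧
    -- integrability: all the flows commute, and all the Hamiltonians, which are independent,
    -- are constants of motion of all the flows
    ((∀ m n : ℕ, VecHier.evol (VecHier.flow L m) (VecHier.flow L n) =
        VecHier.evol (VecHier.flow L n) (VecHier.flow L m)) ∧
      (∀ m n : ℕ, VecHier.IsTotal L (VecHier.evol (VecHier.flow L n) (VecHier.dens L m))) ∧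
      LinearIndependent ℝ (fun n : ℕ => VecHier.varDeriv (VecHier.dens L n))) ∧
    -- the `+1` flow is the NLS equation, the `+2` flow is the complex mKdV equation
    (∀ w : ℝ → ℝ → ℂ, ContDiff ℝ ∞ (Function.uncurry w) →
      (VecHier.Solves (VecHier.flow L 1) w ↔
        ∀ t x, -Complex.I * deriv (fun s => w s x) t =
          iteratedDeriv 2 (w t) x + (1 / 2 : ℂ) * (‖w t x‖ : ℂ) ^ 2 * w t x) ∧
      (VecHier.Solves (VecHier.flow L 2) w ↔
        ∀ t x, -deriv (fun s => w s x) t =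
          iteratedDeriv 3 (w t) x + (3 / 2 : ℂ) * (‖w t x‖ : ℂ) ^ 2 * deriv (w t) x)) := by
  refine ⟨⟨VecHier.isHamiltonian_opH, VecHier.isHamiltonian_opI, VecHier.isHamiltonian_opE,
    VecHier.isHamiltonian_opH_opI, VecHier.isHamiltonian_opE_opH_opI⟩, fun n => ⟨?_, ?_, ?_, ?_⟩,
    fun n => ⟨?_, ?_⟩, fun n hn => ⟨?_, ?_⟩, ⟨fun m n => ?_, fun m n => ?_,
    VecHier.linearIndependent_fn⟩, fun w _ =>
    ⟨VecHier.solves_flow_one w, VecHier.solves_flow_two w⟩⟩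
  · rw [← VecHier.coe_fn, VecHier.dom_opH]
    exact VecHier.hDom_fn n
  · have h := VecHier.isTotal_coe.2 (VecHier.im_star_U_mul_fn_mem (L := L) (n + 1))
    rw [VecHier.coe_im] at h
    rw [← VecHier.coe_fn]
    exact h
  · rw [← VecHier.coe_dn]
    exact (VecHier.dn L n).2
  · rw [← VecHier.coe_dn, VecHier.isReal_coe]
    exact VecHier.star_dn n
  · rw [VecHier.varDeriv_dens, VecHier.dom_opH]
    exact VecHier.hDom_fn n
  · rw [VecHier.varDeriv_dens, VecHier.varDeriv_dens, ← VecHier.coe_Hop, VecHier.Hop_fn,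
      ← VecHier.J_smul, ← neg_smul]
    rfl
  · rw [VecHier.varDeriv_dens, VecHier.dom_opE]
    exact VecHier.eDom_fn _
  · obtain ⟨n, rfl⟩ := Nat.exists_eq_add_of_le' hn
    rw [Nat.add_sub_cancel, VecHier.varDeriv_dens, ← VecHier.coe_Eop, ← VecHier.coe_Hop_fn,
      VecHier.Eop, ← VecHier.fn_succ]
  · rw [← VecHier.coe_Hop_fn, ← VecHier.coe_Hop_fn, ← VecHier.coe_ev, ← VecHier.coe_ev,
      VecHier.ev_flow_comm]
  · rw [← VecHier.coe_Hop_fn, ← VecHier.coe_dn, ← VecHier.coe_ev, VecHier.isTotal_coe]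
    exact VecHier.ev_flow_dn_mem m n
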